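/- Let $n \ge k \ge 0$ be integers and, for a commutative ring $R$ with $1$, let $\mathcal S$ be the $R$-algebra of symmetric polynomials in $R[x_1,\dots,x_k]$. A partition is a weakly decreasing finite sequence $\lambda=(\lambda_1,\dots,\lambda_\ell)$ of positive integers (the empty sequence $\emptyset$ is allowed), with $\ell(\lambda)=\ell$ and $\lambda_i=0$ for $i>\ell$; its conjugate $\lambda'$ has parts $\lambda'_i=\#\{j : \lambda_j\ge i\}$. Let $P_{k,n-k}$ be the set of partitions with at most $k$ parts, each at most $n-k$, and let $Q_{n-k+1,n}$ be the set of partitions of any length all of whose parts are weakly between $n-k+1$ and $n$. In $\mathcal S$ let $e_i$ and $h_i$ be the elementary and the complete homogeneous symmetric polynomials of degree $i$, let $p_i=\sum_{j=1}^k x_j^i$ for $i\ge 1$, and set $f_\lambda=f_{\lambda_1}\cdots f_{\lambda_{\ell(\lambda)}}$ for $f\in\{e,h,p\}$ (so $f_\emptyset=1$). For $\ell(\lambda)\le k$ let $m_\lambda=\sum_a x_1^{a_1}\cdots x_k^{a_k}$, the sum over all distinct permutations $a$ of $(\lambda_1,\dots,\lambda_k)$, and let $$s_\lambda=\frac{\det\big(x_j^{\lambda_i+k-i}\big)_{i,j=1}^k}{\det\big(x_j^{k-i}\big)_{i,j=1}^k}$$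 be the Schur polynomial. (1) If $R$ is a commutative $\mathbb Q$-algebra, then each of the families $$(s_\lambda p_\mu),\qquad (m_\lambda p_\mu),\qquad (e_{\lambda'} p_\mu),$$ indexed by the pairs $(\lambda,\mu)\in P_{k,n-k}\times Q_{n-k+1,n}$, is a basis of the $R$-module $\mathcal S$. (2) If $R$ is any commutative ring, then each of the families $$(s_\lambda h_\mu),\qquad (m_\lambda h_\mu),\qquad (e_{\lambda'} h_\mu),$$ indexed by the pairs $(\lambda,\mu)\in P_{k,n-k}\times Q_{n-k+1,n}$, is a basis of the $R$-module $\mathcal S$. -/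

import Mathlib

noncomputable section

namespace SymmBases

open MvPolynomial

/-- The determinant `det (x_j ^ (a_i))`, `i, j = 0, …, k - 1`, in `R[x_0, …, x_{k-1}]`. -/
def alternant (R : Type*) [CommRing R] (k : ℕ) (a : Fin k → ℕ) : MvPolynomial (Fin k) R :=
  (Matrix.of fun i j : Fin k => (X j : MvPolynomial (Fin k) R) ^ a i).det

/-- The exponents `k - 1, k - 2, …, 0`; `alternant R k (staircase k)` is the denominator
of the quotient of determinants that defines the Schur polynomials. -/
def staircase (k : ℕ) (i : Fin k) : ℕ := k - 1 - (i : ℕ)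

theorem isRegular_X_sub_X (R : Type*) [CommRing R] {k : ℕ} {i j : Fin k} (hij : i ≠ j) :
    IsRegular (X i - X j : MvPolynomial (Fin k) R) := by
  refine isLeftRegular_iff_isRegular.mp fun p q hpq => ?_
  let f : MvPolynomial (Fin k) R →ₐ[R] MvPolynomial (Fin k) R :=
    aeval fun l => if l = i then X i + X j else X l
  let g : MvPolynomial (Fin k) R →ₐ[R] MvPolynomial (Fin k) R :=
    aeval fun l => if l = i then X i - X j else X l
  have hgf : ∀ r, g (f r) = r := by
    intro r
    have h : g.comp f = AlgHom.id R _ := by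
      ext1 l
      by_cases hl : l = i
      · simp [f, g, hl, hij.symm]
      · simp [f, g, hl]
    exact DFunLike.congr_fun h r
  have hX : f (X i - X j) = X i := by simp [f, hij.symm]
  have h : X i * f p = X i * f q := by
    rw [← hX, ← map_mul, ← map_mul]
    exact congrArg f hpq
  have h' : f p = f q := isRegular_X.left h
  rw [← hgf p, ← hgf q, h']

/-- The denominator is a non-zero-divisor, over every commutative ring. -/
theorem isRegular_alternant_staircase (R : Type*) [CommRing R] (k : ℕ) :
    IsRegular (alternant R k (staircase k)) := by
  have h : alternant R k (staircase k) =
      ((Matrix.vandermonde fun i : Fin k => (X i : MvPolynomial (Fin k) R)).transpose.submatrix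
        Fin.revPerm id).det := by
    unfold alternant
    congr 1
    ext1 i j
    simp only [Matrix.of_apply, Matrix.submatrix_apply, Matrix.transpose_apply,
      Matrix.vandermonde_apply, Fin.revPerm_apply, Fin.val_rev, staircase, id_eq]
    congr 1
    omega
  rw [h, Matrix.det_permute, Matrix.det_transpose, Matrix.det_vandermonde]
  refine IsRegular.mul ?_ (IsRegular.prod fun i _ => IsRegular.prod fun j hj =>
    isRegular_X_sub_X R (Finset.mem_Ioi.mp hj).ne')
  exact (((Equiv.Perm.sign (Fin.revPerm : Equiv.Perm (Fin k))).isUnit.map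
    (Int.castRingHom (MvPolynomial (Fin k) R)))).isRegular

/-- The denominator divides every determinant `det (x_j ^ (a_i))`, with a unique quotient. -/
theorem existsUnique_mul_alternant (R : Type*) [CommRing R] (k : ℕ) (a : Fin k → ℕ) :
    ∃! s : MvPolynomial (Fin k) R, s * alternant R k (staircase k) = alternant R k a := by
  suffices h : ∃ s : MvPolynomial (Fin k) R,
      s * alternant R k (staircase k) = alternant R k a by
    obtain ⟨s, hs⟩ := h
    exact ⟨s, hs, fun t ht => (isRegular_alternant_staircase R k).right (ht.trans hs.symm)⟩
  nontriviality R
  let q : Polynomial (MvPolynomial (Fin k) R) := ∏ j : Fin k, (Polynomial.X - Polynomial.C (X j))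
  have hq : q.Monic := Polynomial.monic_prod_of_monic _ _ fun j _ => Polynomial.monic_X_sub_C _
  have hdeg : q.degree = (k : ℕ) := by
    rw [Polynomial.degree_prod_of_monic _ _
      fun (j : Fin k) _ => Polynomial.monic_X_sub_C (X j : MvPolynomial (Fin k) R)]
    simp
  have hroot : ∀ j, q.eval (X j) = 0 := fun j => by
    simp only [q, Polynomial.eval_prod]
    exact Finset.prod_eq_zero (Finset.mem_univ j) (by simp)
  let c : ℕ → Polynomial (MvPolynomial (Fin k) R) := fun m => Polynomial.X ^ m %ₘ q
  have hc : ∀ (m : ℕ) (j : Fin k),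
      (X j : MvPolynomial (Fin k) R) ^ m = ∑ l : Fin k, (c m).coeff (staircase k l) *
        X j ^ staircase k l := by
    intro m j
    have h1 : (c m).eval (X j) = (X j : MvPolynomial (Fin k) R) ^ m := by
      have h2 := congrArg (Polynomial.eval (X j))
        (Polynomial.modByMonic_add_div (Polynomial.X ^ m) q)
      simpa [hroot] using h2
    have h3 : c m = ∑ l ∈ Finset.range k, Polynomial.monomial l ((c m).coeff l) := by
      ext1 d
      simp only [Polynomial.finsetSum_coeff, Polynomial.coeff_monomial, Finset.sum_ite_eq',
        Finset.mem_range]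
      split_ifs with hd
      · rfl
      · refine Polynomial.coeff_eq_zero_of_degree_lt
          ((Polynomial.degree_modByMonic_lt (Polynomial.X ^ m) hq).trans_le ?_)
        rw [hdeg]
        exact_mod_cast not_lt.mp hd
    rw [← h1]
    conv_lhs => rw [h3]
    rw [Polynomial.eval_finsetSum, ← Fin.sum_univ_eq_sum_range
      (fun l => Polynomial.eval (X j) (Polynomial.monomial l ((c m).coeff l)))]
    simp only [Polynomial.eval_monomial]
    rw [← Equiv.sum_comp Fin.revPerm]
    refine Finset.sum_congr rfl fun l _ => ?_
    have : ((Fin.revPerm l : Fin k) : ℕ) = staircase k l := by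
      simp only [Fin.revPerm_apply, Fin.val_rev, staircase]
      omega
    rw [this]
  refine ⟨(Matrix.of fun i l : Fin k => (c (a i)).coeff (staircase k l)).det, ?_⟩
  unfold alternant
  rw [← Matrix.det_mul]
  congr 1
  ext1 i j
  simp only [Matrix.mul_apply, Matrix.of_apply]
  exact (hc (a i) j).symm

/-- The Schur polynomial `s_lam` in `k` variables: the quotient
`det (x_j ^ (lam_i + k - i)) / det (x_j ^ (k - i))` (with `i, j = 1, …, k`) if `lam` has at most
`k` parts, and `0` otherwise. Here `lam.rowLen i` is the part `lam_{i+1}`, or `0` if there is no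
such part. -/
def schur (R : Type*) [CommRing R] (k : ℕ) (lam : YoungDiagram) : MvPolynomial (Fin k) R :=
  if lam.rowLens.length ≤ k then
    (existsUnique_mul_alternant R k fun i => lam.rowLen i + staircase k i).choose
  else 0

theorem schur_mul_alternant (R : Type*) [CommRing R] (k : ℕ) (lam : YoungDiagram)
    (h : lam.rowLens.length ≤ k) :
    schur R k lam * alternant R k (staircase k) =
      alternant R k fun i => lam.rowLen i + staircase k i := by
  rw [schur, if_pos h]
  exact (existsUnique_mul_alternant R k fun i => lam.rowLen i + staircase k i).choose_spec.1

/-- A partition is represented by its Young diagram (the rows are the parts); this is the same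
partition as a multiset of parts. -/
def toPartition (lam : YoungDiagram) : Nat.Partition (lam.rowLens : Multiset ℕ).sum :=
  Nat.Partition.ofMultiset (lam.rowLens : Multiset ℕ)

theorem toPartition_parts (lam : YoungDiagram) :
    (toPartition lam).parts = (lam.rowLens : Multiset ℕ) := by
  simp only [toPartition, Nat.Partition.ofMultiset_parts]
  exact Multiset.filter_eq_self.mpr fun x hx =>
    (lam.pos_of_mem_rowLens x (Multiset.mem_coe.mp hx)).ne'

/-- The partitions with at most `k` parts, each at most `m`. -/
def BoxPartition (k m : ℕ) : Type :=
  {lam : YoungDiagram // lam.rowLens.length ≤ k ∧ ∀ p ∈ lam.rowLens, p ≤ m}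

/-- The partitions (of any length) all of whose parts are weakly between `a` and `b`. -/
def PartsBetween (a b : ℕ) : Type :=
  {mu : YoungDiagram // ∀ p ∈ mu.rowLens, a ≤ p ∧ p ≤ b}

/-- The family `v` of polynomials is an `R`-basis of the ring of symmetric polynomials in
`k` variables: all its members are symmetric, and it is a basis of that `R`-module. -/
def IsSymmBasis {R : Type*} [CommRing R] {k : ℕ} {ι : Type*}
    (v : ι → MvPolynomial (Fin k) R) : Prop :=
  ∃ b : Module.Basis ι R (symmetricSubalgebra (Fin k) R),
    ∀ i, (b i : MvPolynomial (Fin k) R) = v i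

end SymmBases

end

/-! Put `m = n - k`, and let `g` be `h` or `p`. The proof is spanning plus counting. Let `V` be the
module of symmetric polynomials of degree at most `m` in each variable (`boundedSymm`).

Spanning rests on two facts. Each of the families `s_λ`, `m_λ`, `e_{λ'}`, with `λ` in the `k × m`
box, spans `V`. Every symmetric polynomial lies in `V` modulo the ideal of the symmetric polynomials
generated by `g_{m+1}, …, g_{m+k}`. For `h` this comes from expanding a row of an alternant
(`bialternant_mem_symmCombinations`). For `p` it comes from merging exponents in symmetrized
monomials, where positive integers must be inverted (`symmetrization_mem_symmCombinations`). Since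
these generators have positive degree, a graded Nakayama argument (`mem_of_forall_mem_sup`) shows
that the products of a spanning set of `V` with monomials in the generators span everything.

For the count, the box partitions have the Gaussian binomial `∏ (1 - q^(m+i)) / ∏ (1 - q^i)` (with
`1 ≤ i ≤ k`) as generating function, and the `μ` have `∏ 1 / (1 - q^(m+i))`. The product `∏ 1 / (1 -
q^i)` counts the monomials in `e_1, …, e_k`, a known basis (`card_fiber_eq`). In each degree the
family is thus a spanning set of a finite free module with as many members as its rank, hence
independent over any commutative ring (`linearIndependent_of_span_eq`). -/

noncomputable section

namespace SymmBases

/-! ### Generating functions of weighted index sets -/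

/-- The generating function of the weight `w`, whose `d`-th coefficient is the number of
indices of weight `d`. -/
def weightSeries {ι : Type*} (w : ι → ℕ) : PowerSeries ℤ :=
  PowerSeries.mk fun d => (Nat.card {i // w i = d} : ℤ)

theorem coeff_weightSeries {ι : Type*} (w : ι → ℕ) (d : ℕ) :
    PowerSeries.coeff d (weightSeries w) = (Nat.card {i // w i = d} : ℤ) :=
  PowerSeries.coeff_mk _ _

theorem weightSeries_congr {ι κ : Type*} {w : ι → ℕ} {w' : κ → ℕ} (e : ι ≃ κ)
    (h : ∀ i, w' (e i) = w i) : weightSeries w = weightSeries w' := by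
  ext d
  rw [coeff_weightSeries, coeff_weightSeries]
  congr 1
  exact Nat.card_congr (e.subtypeEquiv fun i => by rw [h])

theorem weightSeries_sum {ι κ : Type*} (w : ι → ℕ) (w' : κ → ℕ)
    (hw : ∀ d, Finite {i // w i = d}) (hw' : ∀ d, Finite {i // w' i = d}) :
    weightSeries (Sum.elim w w') = weightSeries w + weightSeries w' := by
  ext d
  have := hw d
  have := hw' d
  rw [map_add, coeff_weightSeries, coeff_weightSeries, coeff_weightSeries]
  have e : {i // Sum.elim w w' i = d} ≃ {i // w i = d} ⊕ {i // w' i = d} :=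
    Equiv.subtypeSum
  rw [Nat.card_congr e, Nat.card_sum]
  push_cast
  rfl

theorem weightSeries_add_const {ι : Type*} (w : ι → ℕ) (c : ℕ) :
    weightSeries (fun i => w i + c) = PowerSeries.X ^ c * weightSeries w := by
  ext d
  rw [PowerSeries.coeff_X_pow_mul', coeff_weightSeries]
  split_ifs with h
  · rw [coeff_weightSeries]
    congr 1
    exact Nat.card_congr (Equiv.subtypeEquivRight fun i => by omega)
  · have : IsEmpty {i // w i + c = d} := ⟨fun i => h (by have := i.2; omega)⟩
    simp

theorem weightSeries_unit : weightSeries (fun _ : Unit => 0) = 1 := by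
  ext d
  rw [coeff_weightSeries, PowerSeries.coeff_one]
  split_ifs with h
  · subst h
    simp
  · have : IsEmpty {i : Unit // 0 = d} := ⟨fun i => h i.2.symm⟩
    simp

def fiberProdEquiv {ι κ : Type*} (w : ι → ℕ) (w' : κ → ℕ) (d : ℕ) :
    {i : ι × κ // w i.1 + w' i.2 = d} ≃
      Σ x : Finset.HasAntidiagonal.antidiagonal d, {i // w i = x.1.1} × {i // w' i = x.1.2} where
  toFun i := ⟨⟨(w i.1.1, w' i.1.2), by simpa using i.2⟩, ⟨i.1.1, rfl⟩, ⟨i.1.2, rfl⟩⟩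
  invFun x := ⟨(x.2.1.1, x.2.2.1), by
    rw [x.2.1.2, x.2.2.2]; exact Finset.HasAntidiagonal.mem_antidiagonal.mp x.1.2⟩
  left_inv i := rfl
  right_inv := by
    rintro ⟨⟨⟨a, b⟩, h⟩, ⟨i, hi⟩, ⟨j, hj⟩⟩
    dsimp only at hi hj
    subst hi hj
    rfl

theorem finite_fiber_prod {ι κ : Type*} {w : ι → ℕ} {w' : κ → ℕ}
    (hw : ∀ d, Finite {i // w i = d}) (hw' : ∀ d, Finite {i // w' i = d}) (d : ℕ) :
    Finite {i : ι × κ // w i.1 + w' i.2 = d} :=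
  Finite.of_equiv _ (fiberProdEquiv w w' d).symm

theorem weightSeries_prod {ι κ : Type*} (w : ι → ℕ) (w' : κ → ℕ)
    (hw : ∀ d, Finite {i // w i = d}) (hw' : ∀ d, Finite {i // w' i = d}) :
    weightSeries (fun i : ι × κ => w i.1 + w' i.2) = weightSeries w * weightSeries w' := by
  ext d
  rw [PowerSeries.coeff_mul, coeff_weightSeries, Nat.card_congr (fiberProdEquiv w w' d),
    Nat.card_sigma, Nat.cast_sum, Finset.sum_coe_sort (Finset.HasAntidiagonal.antidiagonal d)
      (fun x => ((Nat.card ({i // w i = x.1} × {i // w' i = x.2}) : ℕ) : ℤ))]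
  refine Finset.sum_congr rfl fun x _ => ?_
  rw [coeff_weightSeries, coeff_weightSeries, Nat.card_prod]
  push_cast
  rfl

theorem finite_fiber_mul {c : ℕ} (hc : 0 < c) (d : ℕ) : Finite {i : ℕ // i * c = d} := by
  refine Set.Finite.to_subtype ((Set.finite_Iic d).subset fun i hi => ?_)
  have : i * c = d := hi
  exact this ▸ Nat.le_mul_of_pos_right i hc

/-- Removing the index `0` shifts all weights by `c`, so the series `A` satisfies `A = 1 + X ^ c *
A`. -/
theorem weightSeries_nat_mul {c : ℕ} (hc : 0 < c) :
    weightSeries (fun i : ℕ => i * c) * (1 - PowerSeries.X ^ c) = 1 := by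
  have h : weightSeries (fun i : ℕ => i * c) =
      1 + PowerSeries.X ^ c * weightSeries (fun i : ℕ => i * c) := by
    conv_lhs => rw [← weightSeries_congr (w := Sum.elim (fun i : ℕ => i * c + c) fun _ : Unit => 0)
      Equiv.natSumPUnitEquivNat (by
        rintro (i | i)
        · exact Nat.succ_mul i c
        · exact Nat.zero_mul c)]
    rw [weightSeries_sum, weightSeries_add_const, weightSeries_unit, add_comm]
    · intro d
      have := finite_fiber_mul hc (d - c)
      exact Finite.of_injective (β := {i : ℕ // i * c = d - c})
        (fun i => ⟨i.1, by have := i.2; omega⟩)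
        fun i j hij => Subtype.ext (Subtype.mk.inj hij)
    · intro d
      infer_instance
  linear_combination h

theorem finite_fiber_sum_mul {k : ℕ} {w : Fin k → ℕ} (hw : ∀ i, 0 < w i) (d : ℕ) :
    Finite {f : Fin k → ℕ // ∑ i, f i * w i = d} := by
  refine Set.Finite.to_subtype ((Set.finite_Iic (fun _ : Fin k => d)).subset fun f hf => ?_)
  have hf : ∑ i, f i * w i = d := hf
  intro i
  calc f i ≤ f i * w i := Nat.le_mul_of_pos_right _ (hw i)
    _ ≤ _ := Finset.single_le_sum (f := fun i => f i * w i) (fun _ _ => Nat.zero_le _)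
      (Finset.mem_univ i)
    _ = d := hf

theorem weightSeries_sum_mul {k : ℕ} {w : Fin k → ℕ} (hw : ∀ i, 0 < w i) :
    weightSeries (fun f : Fin k → ℕ => ∑ i, f i * w i) * ∏ i, (1 - PowerSeries.X ^ w i) = 1 := by
  induction k with
  | zero =>
    rw [weightSeries_congr (w' := fun _ : Unit => 0) (Equiv.ofUnique _ _) (by simp),
      weightSeries_unit]
    simp
  | succ k ih =>
    rw [← weightSeries_congr
      (w := fun f : ℕ × (Fin k → ℕ) => f.1 * w (Fin.last k) + ∑ i, f.2 i * w i.castSucc)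
      (Fin.snocEquiv fun _ => ℕ) (by
        intro f
        rw [Fin.sum_univ_castSucc, add_comm]
        simp [Fin.snocEquiv])]
    rw [weightSeries_prod (fun i => i * w (Fin.last k))
      (fun f : Fin k → ℕ => ∑ i, f i * w i.castSucc) (finite_fiber_mul (hw _))
      (finite_fiber_sum_mul fun i => hw _), Fin.prod_univ_castSucc]
    linear_combination (weightSeries_nat_mul (hw (Fin.last k))) *
      (weightSeries (fun f : Fin k → ℕ => ∑ i, f i * w i.castSucc) *
        ∏ i : Fin k, (1 - PowerSeries.X ^ w i.castSucc)) +
      ih (w := fun i => w i.castSucc) fun i => hw _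

/-! ### The Gaussian binomial identity -/

/-- The exponent vectors of total degree at most `m`. -/
abbrev BoundedExponents (k m : ℕ) : Type := {f : Fin k → ℕ // ∑ i, f i ≤ m}

/-- The weight of an exponent vector, when the `i`-th variable has weight `i + 1`. -/
def BoundedExponents.weight {k m : ℕ} (f : BoundedExponents k m) : ℕ :=
  ∑ i, f.1 i * ((i : ℕ) + 1)

instance (k m : ℕ) : Finite (BoundedExponents k m) := by
  refine Set.Finite.to_subtype ((Set.finite_Iic (fun _ : Fin k => m)).subset fun f hf => ?_)
  exact fun i => (Finset.single_le_sum (fun _ _ => Nat.zero_le _) (Finset.mem_univ i)).trans hf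

/-- Split the exponent vectors according to whether the last exponent is zero. -/
def boundedExponentsSplit (k m : ℕ) :
    BoundedExponents k (m + 1) ⊕ BoundedExponents (k + 1) m → BoundedExponents (k + 1) (m + 1) :=
  Sum.elim (fun f => ⟨Fin.snoc (α := fun _ => ℕ) f.1 0, by simpa [Fin.sum_univ_castSucc] using f.2⟩)
    (fun f => ⟨f.1 + Pi.single (Fin.last k) 1, by
      simpa [Finset.sum_add_distrib] using f.2⟩)

theorem boundedExponentsSplit_bijective (k m : ℕ) :
    Function.Bijective (boundedExponentsSplit k m) := by
  constructor
  · rintro (f | f) (g | g) h <;> have h := congrArg Subtype.val h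
    · refine congrArg Sum.inl (Subtype.ext ?_)
      exact (Fin.snoc_injective2 (α := fun _ => ℕ) h).1
    · have := congrFun h (Fin.last k)
      simp [boundedExponentsSplit] at this
    · have := congrFun h (Fin.last k)
      simp [boundedExponentsSplit] at this
    · refine congrArg Sum.inr (Subtype.ext ?_)
      exact add_right_cancel h
  · intro f
    by_cases h : f.1 (Fin.last k) = 0
    · refine ⟨Sum.inl ⟨fun i => f.1 i.castSucc, ?_⟩, Subtype.ext ?_⟩
      · have := f.2
        rw [Fin.sum_univ_castSucc] at this
        exact (Nat.le_add_right _ _).trans this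
      · ext i
        refine Fin.lastCases ?_ (fun i => ?_) i <;> simp [boundedExponentsSplit, h]
    · have hf : f.1 - Pi.single (Fin.last k) 1 + Pi.single (Fin.last k) 1 = f.1 := by
        ext i
        by_cases hi : i = Fin.last k
        · subst hi
          simp
          omega
        · simp [hi]
      refine ⟨Sum.inr ⟨f.1 - Pi.single (Fin.last k) 1, ?_⟩, Subtype.ext hf⟩
      have := f.2
      rw [← hf] at this
      simpa [Finset.sum_add_distrib] using this

/-- This is the product formula for the Gaussian binomial, cleared of denominators. It follows from
the `q`-Pascal rule `B(k+1, m+1) = B(k, m+1) + q^(k+1) B(k+1, m)`: either the last exponent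
vanishes, or it can be lowered by one at the cost of weight `k + 1`. -/
theorem weightSeries_boundedExponents (k m : ℕ) :
    weightSeries (BoundedExponents.weight (k := k) (m := m)) *
      ∏ i : Fin k, (1 - PowerSeries.X ^ ((i : ℕ) + 1)) =
    ∏ i : Fin k, (1 - PowerSeries.X ^ (m + 1 + (i : ℕ))) := by
  induction k generalizing m with
  | zero =>
    have : Unique (BoundedExponents 0 m) := ⟨⟨⟨0, by simp⟩⟩, fun f => Subtype.ext (by ext i; exact i.elim0)⟩
    rw [weightSeries_congr (w' := fun _ : Unit => 0) (Equiv.ofUnique _ _)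
      (by simp [BoundedExponents.weight]), weightSeries_unit]
    simp
  | succ k ihk =>
    induction m with
    | zero =>
      have : Unique (BoundedExponents (k + 1) 0) := ⟨⟨⟨0, by simp⟩⟩, fun f => Subtype.ext (by
        ext i
        have := f.2
        simp only [nonpos_iff_eq_zero, Finset.sum_eq_zero_iff, Finset.mem_univ, true_imp_iff] at this
        exact this i)⟩
      rw [weightSeries_congr (w' := fun _ : Unit => 0) (Equiv.ofUnique _ _)
        (fun f => by rw [Subsingleton.elim f ⟨0, by simp⟩]; simp [BoundedExponents.weight]),
        weightSeries_unit]
      simp [add_comm]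
    | succ m ihm =>
      rw [← weightSeries_congr (w := Sum.elim (BoundedExponents.weight (k := k) (m := m + 1))
        (fun f => BoundedExponents.weight (k := k + 1) (m := m) f + (k + 1)))
        (Equiv.ofBijective _ (boundedExponentsSplit_bijective k m)) (by
          rintro (f | f)
          · simp [boundedExponentsSplit, BoundedExponents.weight, Fin.sum_univ_castSucc]
          · simp [boundedExponentsSplit, BoundedExponents.weight, Fin.sum_univ_castSucc]
            ring),
        weightSeries_sum _ _ (fun d => inferInstance) (fun d => inferInstance),
        weightSeries_add_const, add_mul]
      rw [mul_assoc, ihm, Fin.prod_univ_castSucc, ← mul_assoc]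
      simp only [Fin.val_castSucc, Fin.val_last]
      rw [ihk, Fin.prod_univ_succ, Fin.prod_univ_castSucc]
      simp only [Fin.val_succ, Fin.val_zero, Fin.val_castSucc, Fin.val_last]
      have h : ∏ i : Fin k, (1 - (PowerSeries.X : PowerSeries ℤ) ^ (m + 1 + ((i : ℕ) + 1))) =
          ∏ i : Fin k, (1 - PowerSeries.X ^ (m + 1 + 1 + (i : ℕ))) :=
        Finset.prod_congr rfl fun i _ => by rw [add_assoc (m + 1), add_comm 1 (i : ℕ)]
      rw [h]
      ring

/-- Exponent vectors of degree at most `m` in variables of weights `1, …, k`, together with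
arbitrary exponent vectors in variables of weights `m + 1, …, m + k`, are equinumerous with
exponent vectors in variables of weights `1, …, k`, weight by weight. -/
theorem card_fiber_eq (k m d : ℕ) :
    Nat.card {x : BoundedExponents k m × (Fin k → ℕ) //
      x.1.weight + ∑ i, x.2 i * (m + 1 + (i : ℕ)) = d} =
    Nat.card {f : Fin k → ℕ // ∑ i, f i * ((i : ℕ) + 1) = d} := by
  have h1 := weightSeries_boundedExponents k m
  have h2 := weightSeries_sum_mul (k := k) (w := fun i => m + 1 + i) (by intro i; omega)
  have h3 := weightSeries_sum_mul (k := k) (w := fun i => i + 1) (by intro i; omega)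
  have h4 := weightSeries_prod (BoundedExponents.weight (k := k) (m := m))
    (fun f : Fin k → ℕ => ∑ i, f i * (m + 1 + (i : ℕ))) (fun d => inferInstance)
    (finite_fiber_sum_mul (by intro i; omega))
  have h5 : weightSeries (fun x : BoundedExponents k m × (Fin k → ℕ) =>
      x.1.weight + ∑ i, x.2 i * (m + 1 + (i : ℕ))) =
      weightSeries (fun f : Fin k → ℕ => ∑ i, f i * ((i : ℕ) + 1)) := by
    rw [h4]
    generalize weightSeries (BoundedExponents.weight (k := k) (m := m)) = B at *
    generalize weightSeries (fun f : Fin k → ℕ => ∑ i, f i * (m + 1 + (i : ℕ))) = W at *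
    generalize weightSeries (fun f : Fin k → ℕ => ∑ i, f i * ((i : ℕ) + 1)) = U at *
    -- With `P` and `Q` the products for weights `1, …, k` and `m + 1, …, m + k`, the facts are `B P
    -- = Q`, `W Q = 1`, `U P = 1`; together they give `B W = U`.
    linear_combination U * W * h1 - B * W * h3 + U * h2
  have := congrArg (PowerSeries.coeff d) h5
  rw [coeff_weightSeries, coeff_weightSeries] at this
  exact_mod_cast this

/-! ### Partitions as vectors of multiplicities -/

theorem rowLens_coe_injective :
    Function.Injective fun mu : YoungDiagram => (mu.rowLens : Multiset ℕ) := by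
  intro mu nu h
  have h : mu.rowLens.Perm nu.rowLens := Multiset.coe_eq_coe.mp h
  exact YoungDiagram.equivListRowLens.injective
    (Subtype.ext (h.eq_of_sortedGE mu.rowLens_sorted nu.rowLens_sorted))

theorem exists_rowLens_coe_eq (s : Multiset ℕ) (hs : ∀ p ∈ s, 0 < p) :
    ∃ mu : YoungDiagram, (mu.rowLens : Multiset ℕ) = s := by
  refine ⟨YoungDiagram.ofRowLens (s.sort (· ≥ ·)) (s.pairwise_sort (· ≥ ·)).sortedGE, ?_⟩
  rw [YoungDiagram.rowLens_ofRowLens_eq_self, Multiset.sort_eq]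
  intro x hx
  exact hs x (by simpa using hx)

theorem le_rowLen_zero {mu : YoungDiagram} {p : ℕ} (hp : p ∈ mu.rowLens) : p ≤ mu.rowLen 0 := by
  simp only [YoungDiagram.rowLens, List.mem_map] at hp
  obtain ⟨i, -, rfl⟩ := hp
  exact mu.rowLen_anti _ _ (Nat.zero_le _)

theorem forall_mem_rowLens_le_iff {mu : YoungDiagram} {m : ℕ} :
    (∀ p ∈ mu.rowLens, p ≤ m) ↔ mu.rowLen 0 ≤ m := by
  refine ⟨fun h => ?_, fun h p hp => (le_rowLen_zero hp).trans h⟩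
  by_cases h0 : mu.rowLen 0 = 0
  · omega
  · refine h _ (List.mem_map.mpr ⟨0, List.mem_range.mpr ?_, rfl⟩)
    rw [← YoungDiagram.mem_iff_lt_colLen, YoungDiagram.mem_iff_lt_rowLen]
    omega

theorem sum_rowLens (mu : YoungDiagram) : mu.rowLens.sum = mu.card := by
  rw [YoungDiagram.rowLens, ← List.sum_toFinset _ List.nodup_range, List.toFinset_range,
    YoungDiagram.card, Finset.card_eq_sum_card_fiberwise (f := Prod.fst)
      (t := Finset.range (mu.colLen 0))]
  · exact Finset.sum_congr rfl fun i _ => mu.rowLen_eq_card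
  · intro c hc
    rw [Finset.coe_range, Set.mem_Iio, ← YoungDiagram.mem_iff_lt_colLen]
    exact mu.up_left_mem le_rfl (Nat.zero_le _) (Finset.mem_coe.mp hc)

theorem sum_rowLens_transpose (mu : YoungDiagram) :
    mu.transpose.rowLens.sum = mu.rowLens.sum := by
  rw [sum_rowLens, sum_rowLens, YoungDiagram.card, YoungDiagram.card]
  exact Finset.card_map _

/-- The offset `a` serves two uses: `a = m` for the partitions `μ`, and `a = 0` for conjugates of
box partitions, whence the bounds `0 + 1` and `0 + k` below. -/
theorem multiset_eq_sum_count {a k : ℕ} {s : Multiset ℕ} (hs : ∀ p ∈ s, a + 1 ≤ p ∧ p ≤ a + k) :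
    s = ∑ i : Fin k, s.count (a + 1 + (i : ℕ)) • {a + 1 + (i : ℕ)} := by
  ext p
  rw [Multiset.count_sum']
  simp only [Multiset.count_nsmul, Multiset.count_singleton]
  by_cases hp : a + 1 ≤ p ∧ p ≤ a + k
  · have hi : p - (a + 1) < k := by omega
    rw [Finset.sum_eq_single ⟨p - (a + 1), hi⟩]
    · have : a + 1 + (p - (a + 1)) = p := by omega
      simp [this]
    · intro i _ hne
      rw [if_neg, mul_zero]
      rintro rfl
      exact hne (Fin.ext (by simp))
    · simp
  · rw [Multiset.count_eq_zero_of_notMem fun h => hp (hs p h), Finset.sum_eq_zero]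
    intro i _
    rw [if_neg, mul_zero]
    rintro rfl
    omega

theorem prod_map_eq_prod_pow_count {M : Type*} [CommMonoid M] (g : ℕ → M) {a k : ℕ}
    {s : Multiset ℕ} (hs : ∀ p ∈ s, a + 1 ≤ p ∧ p ≤ a + k) :
    (s.map g).prod = ∏ i : Fin k, g (a + 1 + (i : ℕ)) ^ s.count (a + 1 + (i : ℕ)) := by
  conv_lhs => rw [multiset_eq_sum_count hs]
  rw [← Multiset.coe_mapAddMonoidHom, map_sum, Multiset.prod_sum]
  simp [Multiset.map_nsmul, Multiset.prod_nsmul]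

theorem sum_eq_sum_count_mul {a k : ℕ} {s : Multiset ℕ} (hs : ∀ p ∈ s, a + 1 ≤ p ∧ p ≤ a + k) :
    s.sum = ∑ i : Fin k, s.count (a + 1 + (i : ℕ)) * (a + 1 + (i : ℕ)) := by
  conv_lhs => rw [multiset_eq_sum_count hs]
  simp [Multiset.sum_sum, Multiset.sum_nsmul]

theorem card_eq_sum_count {a k : ℕ} {s : Multiset ℕ} (hs : ∀ p ∈ s, a + 1 ≤ p ∧ p ≤ a + k) :
    s.card = ∑ i : Fin k, s.count (a + 1 + (i : ℕ)) := by
  conv_lhs => rw [multiset_eq_sum_count hs]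
  simp

/-- A partition with parts between `a + 1` and `a + k` is given by the multiplicities. -/
def multiplicities (a k : ℕ) (mu : PartsBetween (a + 1) (a + k)) (i : Fin k) : ℕ :=
  (mu.1.rowLens : Multiset ℕ).count (a + 1 + (i : ℕ))

theorem PartsBetween.forall_mem {a b : ℕ} (mu : PartsBetween a b) :
    ∀ p ∈ (mu.1.rowLens : Multiset ℕ), a ≤ p ∧ p ≤ b := fun p hp => mu.2 p (by simpa using hp)

theorem PartsBetween.exists_eq {a b : ℕ} {s : Multiset ℕ} (hs : ∀ p ∈ s, a + 1 ≤ p ∧ p ≤ b) :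
    ∃ mu : PartsBetween (a + 1) b, (mu.1.rowLens : Multiset ℕ) = s := by
  obtain ⟨mu, hmu⟩ := exists_rowLens_coe_eq s fun p hp => by have := hs p hp; omega
  exact ⟨⟨mu, fun p hp => hs p (by rw [← hmu]; simpa using hp)⟩, hmu⟩

theorem multiplicities_bijective (a k : ℕ) : Function.Bijective (multiplicities a k) := by
  constructor
  · intro mu nu h
    refine Subtype.ext (rowLens_coe_injective ?_)
    dsimp only
    rw [multiset_eq_sum_count mu.forall_mem, multiset_eq_sum_count nu.forall_mem]
    exact Finset.sum_congr rfl fun i _ => congrArg (· • _) (congrFun h i)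
  · intro f
    obtain ⟨mu, hmu⟩ := PartsBetween.exists_eq (a := a) (b := a + k)
      (s := ∑ i : Fin k, f i • {a + 1 + (i : ℕ)}) (by
        intro p hp
        rw [Multiset.mem_sum] at hp
        obtain ⟨i, -, hi⟩ := hp
        rw [Multiset.mem_singleton.mp (Multiset.mem_of_mem_nsmul hi)]
        omega)
    refine ⟨mu, funext fun i => ?_⟩
    rw [multiplicities, hmu, Multiset.count_sum', Finset.sum_eq_single i]
    · simp
    · intro j _ hj
      simp only [Multiset.count_nsmul, Multiset.count_singleton]
      rw [if_neg, mul_zero]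
      intro h
      exact hj (Fin.ext (by omega))
    · simp

/-- The conjugate of a partition with at most `k` parts has parts between `1` and `k`. -/
def BoxPartition.conj {k m : ℕ} (lam : BoxPartition k m) : PartsBetween (0 + 1) (0 + k) :=
  ⟨lam.1.transpose, fun p hp => ⟨lam.1.transpose.pos_of_mem_rowLens p hp, by
    have := le_rowLen_zero hp
    rw [YoungDiagram.rowLen_transpose, ← YoungDiagram.length_rowLens] at this
    have := lam.2.1
    omega⟩⟩

/-- The multiplicities of the parts of the conjugate partition. -/
def boxMultiplicities (k m : ℕ) (lam : BoxPartition k m) : BoundedExponents k m :=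
  ⟨multiplicities 0 k lam.conj, by
    refine (card_eq_sum_count lam.conj.forall_mem).symm.trans_le ?_
    rw [Multiset.coe_card, YoungDiagram.length_rowLens]
    change lam.1.transpose.colLen 0 ≤ m
    rw [YoungDiagram.colLen_transpose, ← forall_mem_rowLens_le_iff]
    exact lam.2.2⟩

/-- Conjugation exchanges number of parts and largest part: "at most `k` parts" becomes "parts at
most `k`", and "parts at most `m`" becomes the bound `m` on the sum of the multiplicities. -/
theorem boxMultiplicities_bijective (k m : ℕ) : Function.Bijective (boxMultiplicities k m) := by
  constructor
  · intro lam nu h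
    have := (multiplicities_bijective 0 k).1 (congrArg Subtype.val h)
    exact Subtype.ext (YoungDiagram.transpose_eq_iff.mp (congrArg Subtype.val this))
  · intro f
    obtain ⟨mu, hmu⟩ := (multiplicities_bijective 0 k).2 f.1
    refine ⟨⟨mu.1.transpose, ?_, ?_⟩, Subtype.ext ?_⟩
    · rw [YoungDiagram.length_rowLens, YoungDiagram.colLen_transpose,
        ← forall_mem_rowLens_le_iff]
      intro p hp
      have := (mu.2 p hp).2
      omega
    · rw [forall_mem_rowLens_le_iff, YoungDiagram.rowLen_transpose, ← YoungDiagram.length_rowLens,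
        ← Multiset.coe_card, card_eq_sum_count mu.forall_mem]
      have := f.2
      rw [← hmu] at this
      exact this
    · refine Eq.trans ?_ hmu
      change multiplicities 0 k _ = _
      congr 1
      exact Subtype.ext (YoungDiagram.transpose_transpose mu.1)

/-- The size of the partition pair `(lam, mu)`. -/
def pairDegree {k a b m : ℕ} (x : BoxPartition k m × PartsBetween a b) : ℕ :=
  x.1.1.rowLens.sum + x.2.1.rowLens.sum

theorem weight_boxMultiplicities {k m : ℕ} (lam : BoxPartition k m) :
    (boxMultiplicities k m lam).weight = lam.1.rowLens.sum := by
  rw [← sum_rowLens_transpose, ← Multiset.sum_coe]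
  refine Eq.trans ?_ (sum_eq_sum_count_mul lam.conj.forall_mem).symm
  refine Finset.sum_congr rfl fun i _ => ?_
  change multiplicities 0 k lam.conj i * _ = multiplicities 0 k lam.conj i * (0 + 1 + (i : ℕ))
  rw [zero_add, add_comm 1]

theorem pairDegree_eq {k m : ℕ} (x : BoxPartition k m × PartsBetween (m + 1) (m + k)) :
    pairDegree x = (boxMultiplicities k m x.1).weight +
      ∑ i, multiplicities m k x.2 i * (m + 1 + (i : ℕ)) := by
  rw [pairDegree, weight_boxMultiplicities, ← Multiset.sum_coe x.2.1.rowLens]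
  exact congrArg _ (sum_eq_sum_count_mul x.2.forall_mem)

def pairEquiv (k m d : ℕ) :
    {x : BoxPartition k m × PartsBetween (m + 1) (m + k) // pairDegree x = d} ≃
      {x : BoundedExponents k m × (Fin k → ℕ) //
        x.1.weight + ∑ i, x.2 i * (m + 1 + (i : ℕ)) = d} :=
  ((Equiv.ofBijective _ (boxMultiplicities_bijective k m)).prodCongr
    (Equiv.ofBijective _ (multiplicities_bijective m k))).subtypeEquiv fun x => by
      rw [pairDegree_eq]
      rfl

theorem finite_pairDegree_fiber (k m d : ℕ) :
    Finite {x : BoxPartition k m × PartsBetween (m + 1) (m + k) // pairDegree x = d} := by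
  have := finite_fiber_prod (w := BoundedExponents.weight (k := k) (m := m))
    (w' := fun f : Fin k → ℕ => ∑ i, f i * (m + 1 + (i : ℕ))) (fun _ => inferInstance)
    (finite_fiber_sum_mul fun i => by omega) d
  exact Finite.of_equiv _ (pairEquiv k m d).symm

theorem card_pairDegree_fiber (k m d : ℕ) :
    Nat.card {x : BoxPartition k m × PartsBetween (m + 1) (m + k) // pairDegree x = d} =
      Nat.card {f : Fin k → ℕ // ∑ i, f i * ((i : ℕ) + 1) = d} :=
  (Nat.card_congr (pairEquiv k m d)).trans (card_fiber_eq k m d)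

/-! ### Linear independence from spanning and counting -/

open MvPolynomial

/-- A family that spans the span of a finite linearly independent family of the same
cardinality is linearly independent. -/
theorem linearIndependent_of_span_eq {R M ι τ : Type*} [CommRing R] [AddCommGroup M] [Module R M]
    [Finite τ] (e : ι ≃ τ) {b : τ → M} (hb : LinearIndependent R b) {v : ι → M}
    (h : Submodule.span R (Set.range v) = Submodule.span R (Set.range b)) :
    LinearIndependent R v := by
  have hmem : ∀ c : ι →₀ R, Finsupp.linearCombination R v c ∈ Submodule.span R (Set.range b) := by
    intro c
    rw [← h, ← Finsupp.range_linearCombination]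
    exact LinearMap.mem_range_self _ c
  let T : (ι →₀ R) →ₗ[R] Submodule.span R (Set.range b) :=
    (Finsupp.linearCombination R v).codRestrict _ hmem
  have hT : Function.Surjective T := by
    rintro ⟨x, hx⟩
    rw [← h, ← Finsupp.range_linearCombination] at hx
    obtain ⟨c, rfl⟩ := hx
    exact ⟨c, rfl⟩
  have : Module.Finite R (Submodule.span R (Set.range b)) :=
    Module.Finite.span_of_finite R (Set.finite_range b)
  -- Over a commutative ring, a surjection onto a finitely generated module from a module that also
  -- embeds in it is injective. The embedding here is given by `b` along `e`, the surjection by `v`.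
  have hinj := OrzechProperty.injective_of_surjective_of_injective
    ((Finsupp.linearCombination R b).codRestrict (Submodule.span R (Set.range b))
      (fun c => by
        rw [← Finsupp.range_linearCombination]
        exact LinearMap.mem_range_self _ c) ∘ₗ (Finsupp.domLCongr e).toLinearMap) T
    (by
      intro c c' hc
      have := congrArg Subtype.val hc
      exact (Finsupp.domLCongr e).injective (hb this)) hT
  intro c c' hc
  exact hinj (Subtype.ext hc)

variable {R : Type*} [CommRing R] {k : ℕ}

theorem homogeneousComponent_mem_span {ι : Type*} {v : ι → MvPolynomial (Fin k) R} {deg : ι → ℕ}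
    (hv : ∀ i, (v i).IsHomogeneous (deg i)) (d : ℕ) {f : MvPolynomial (Fin k) R}
    (hf : f ∈ Submodule.span R (Set.range v)) :
    homogeneousComponent d f ∈
      Submodule.span R (Set.range fun i : {i // deg i = d} => v i) := by
  induction hf using Submodule.span_induction with
  | mem x hx =>
    obtain ⟨i, rfl⟩ := hx
    rw [homogeneousComponent_of_mem (hv i)]
    split_ifs with h
    · exact Submodule.subset_span ⟨⟨i, h.symm⟩, rfl⟩
    · exact Submodule.zero_mem _
  | zero => simp
  | add x y _ _ hx hy => rw [map_add]; exact Submodule.add_mem _ hx hy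
  | smul c x _ hx => rw [map_smul]; exact Submodule.smul_mem _ c hx

/-- Homogeneous components of a linear relation are again relations, each involving a single degree.
-/
theorem linearIndependent_of_homogeneous {ι : Type*} {v : ι → MvPolynomial (Fin k) R}
    {deg : ι → ℕ} (hv : ∀ i, (v i).IsHomogeneous (deg i))
    (h : ∀ d, LinearIndependent R fun i : {i // deg i = d} => v i) : LinearIndependent R v := by
  rw [linearIndependent_iff']
  intro s c hc i hi
  have h1 := (linearIndependent_iff'.mp (h (deg i))) (s.subtype fun j => deg j = deg i)
    (fun j => c j) (by
      rw [Finset.sum_subtype_eq_sum_filter (f := fun j => c j • v j), Finset.sum_filter]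
      have h2 := congrArg (homogeneousComponent (deg i)) hc
      rw [map_sum, map_zero] at h2
      conv_rhs => rw [← h2]
      refine Finset.sum_congr rfl fun j _ => ?_
      rw [map_smul, homogeneousComponent_of_mem (hv j)]
      by_cases hj : deg j = deg i
      · rw [if_pos hj, if_pos hj.symm]
      · rw [if_neg hj, if_neg (Ne.symm hj), smul_zero])
  exact h1 ⟨i, rfl⟩ (by simpa using hi)

/-- The monomials in the elementary symmetric polynomials. -/
def esymmMonomial (R : Type*) [CommRing R] (k : ℕ) (t : Fin k → ℕ) : MvPolynomial (Fin k) R :=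
  ∏ i : Fin k, esymm (Fin k) R ((i : ℕ) + 1) ^ t i

theorem esymm_isHomogeneous (R : Type*) [CommRing R] (k d : ℕ) :
    (esymm (Fin k) R d).IsHomogeneous d := by
  refine IsHomogeneous.sum _ _ _ fun s hs => ?_
  have := IsHomogeneous.prod s (fun i => (X i : MvPolynomial (Fin k) R)) (fun _ => 1)
    fun i _ => isHomogeneous_X R i
  simpa [(Finset.mem_powersetCard.mp hs).2] using this

theorem esymmMonomial_isHomogeneous (t : Fin k → ℕ) :
    (esymmMonomial R k t).IsHomogeneous (∑ i, t i * ((i : ℕ) + 1)) := by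
  refine IsHomogeneous.prod _ _ _ fun i _ => ?_
  rw [mul_comm]
  exact (esymm_isHomogeneous R k _).pow _

theorem esymmAlgHomMonomial_eq (t : Fin k →₀ ℕ) (r : R) :
    esymmAlgHomMonomial (Fin k) t r = r • esymmMonomial R k t := by
  rw [esymmAlgHomMonomial, esymmAlgHom_apply, aeval_monomial, esymmMonomial,
    Finsupp.prod_fintype _ _ (fun i => pow_zero _), Algebra.smul_def]

theorem esymmMonomial_mem (t : Fin k → ℕ) :
    esymmMonomial R k t ∈ symmetricSubalgebra (Fin k) R :=
  Subalgebra.prod_mem _ fun _ _ => Subalgebra.pow_mem _ (esymm_isSymmetric _ _ _) _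

/-- The monomials in the elementary symmetric polynomials form a basis. -/
def esymmBasis (R : Type*) [CommRing R] (k : ℕ) :
    Module.Basis (Fin k → ℕ) R (symmetricSubalgebra (Fin k) R) :=
  ((basisMonomials (Fin k) R).map
    (esymmAlgEquiv (Fin k) R (Fintype.card_fin k)).toLinearEquiv).reindex Finsupp.equivFunOnFinite

theorem esymmBasis_coe (t : Fin k → ℕ) :
    (esymmBasis R k t : MvPolynomial (Fin k) R) = esymmMonomial R k t := by
  have h := esymmAlgHomMonomial_eq (R := R) (Finsupp.equivFunOnFinite.symm t) 1
  rw [one_smul] at h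
  rw [esymmBasis, Module.Basis.reindex_apply, Module.Basis.map_apply, coe_basisMonomials]
  exact h

theorem subtype_comp_esymmBasis :
    (symmetricSubalgebra (Fin k) R).toSubmodule.subtype ∘ esymmBasis R k = esymmMonomial R k :=
  _root_.funext esymmBasis_coe

theorem linearIndependent_esymmMonomial : LinearIndependent R (esymmMonomial R k) := by
  have h := (esymmBasis R k).linearIndependent.map'
    (symmetricSubalgebra (Fin k) R).toSubmodule.subtype (Submodule.ker_subtype _)
  rw [subtype_comp_esymmBasis] at h
  exact h

theorem mem_span_esymmMonomial {f : MvPolynomial (Fin k) R} (hf : f.IsSymmetric) :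
    f ∈ Submodule.span R (Set.range (esymmMonomial R k)) := by
  have h : (⟨f, hf⟩ : symmetricSubalgebra (Fin k) R) ∈
      Submodule.span R (Set.range (esymmBasis R k)) := by
    rw [(esymmBasis R k).span_eq]
    trivial
  have h := Submodule.mem_map_of_mem
    (f := (symmetricSubalgebra (Fin k) R).toSubmodule.subtype) h
  rw [Submodule.map_span, ← Set.range_comp, subtype_comp_esymmBasis] at h
  exact h

/-- A spanning family of homogeneous symmetric polynomials with the right number of members in
every degree is a basis. -/
theorem isSymmBasis_of_span {ι : Type*} {v : ι → MvPolynomial (Fin k) R} {deg : ι → ℕ}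
    (hv : ∀ i, (v i).IsHomogeneous (deg i)) (hsymm : ∀ i, (v i).IsSymmetric)
    (hspan : ∀ f : MvPolynomial (Fin k) R, f.IsSymmetric → f ∈ Submodule.span R (Set.range v))
    (hfin : ∀ d, Finite {i // deg i = d})
    (hcard : ∀ d, Nat.card {i // deg i = d} =
      Nat.card {f : Fin k → ℕ // ∑ i, f i * ((i : ℕ) + 1) = d}) :
    IsSymmBasis v := by
  have hli : LinearIndependent R v := by
    refine linearIndependent_of_homogeneous hv fun d => ?_
    -- `Nat.card` is `0` on infinite types, so equal cardinalities yield a bijection only once both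
    -- fibres are known to be finite.
    have := hfin d
    have : Finite {f : Fin k → ℕ // ∑ i, f i * ((i : ℕ) + 1) = d} :=
      finite_fiber_sum_mul (fun i => Nat.succ_pos _) d
    refine linearIndependent_of_span_eq (Finite.card_eq.mp (hcard d)).some
      (linearIndependent_esymmMonomial.comp _ Subtype.val_injective) (le_antisymm ?_ ?_)
    · rw [Submodule.span_le]
      rintro _ ⟨i, rfl⟩
      have := homogeneousComponent_mem_span (fun t => esymmMonomial_isHomogeneous (R := R) t) d
        (mem_span_esymmMonomial (hsymm i))
      rwa [homogeneousComponent_of_mem (hv i), if_pos i.2.symm] at this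
    · rw [Submodule.span_le]
      rintro _ ⟨t, rfl⟩
      have := homogeneousComponent_mem_span hv d (hspan _ (esymmMonomial_mem (R := R) t.1))
      rwa [homogeneousComponent_of_mem (esymmMonomial_isHomogeneous (R := R) t.1),
        if_pos t.2.symm] at this
  let w : ι → symmetricSubalgebra (Fin k) R := fun i => ⟨v i, hsymm i⟩
  have hw : LinearIndependent R w :=
    LinearIndependent.of_comp (symmetricSubalgebra (Fin k) R).toSubmodule.subtype hli
  refine ⟨Module.Basis.mk hw ?_, fun i => by rw [Module.Basis.mk_apply]⟩
  rintro ⟨f, hf⟩ -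
  have h := hspan f hf
  have hr : Set.range v = (symmetricSubalgebra (Fin k) R).toSubmodule.subtype '' Set.range w := by
    rw [← Set.range_comp]
    rfl
  rw [hr, ← Submodule.map_span] at h
  obtain ⟨g, hg, hgf⟩ := h
  have : g = ⟨f, hf⟩ := Subtype.ext hgf
  exact this ▸ hg

/-! ### Bounded symmetric polynomials and graded Nakayama -/

/-- The symmetric polynomials whose degree in each variable is at most `m`. -/
def boundedSymm (R : Type*) [CommRing R] (k m : ℕ) : Submodule R (MvPolynomial (Fin k) R) where
  carrier := {f | f.IsSymmetric ∧ ∀ i, f.degreeOf i ≤ m}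
  zero_mem' := ⟨IsSymmetric.zero, fun i => by simp⟩
  add_mem' hf hg := ⟨hf.1.add hg.1, fun i =>
    (degreeOf_add_le _ _ _).trans (max_le (hf.2 i) (hg.2 i))⟩
  smul_mem' c f hf := ⟨hf.1.smul c, fun i => by
    rw [smul_eq_C_mul]
    exact (degreeOf_C_mul_le _ _ _).trans (hf.2 i)⟩

theorem mem_boundedSymm {m : ℕ} {f : MvPolynomial (Fin k) R} :
    f ∈ boundedSymm R k m ↔ f.IsSymmetric ∧ ∀ i, f.degreeOf i ≤ m := Iff.rfl

theorem mem_boundedSymm_iff_support {m : ℕ} {f : MvPolynomial (Fin k) R} :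
    f ∈ boundedSymm R k m ↔ f.IsSymmetric ∧ ∀ a ∈ f.support, ∀ i, a i ≤ m := by
  simp only [mem_boundedSymm, degreeOf_le_iff]
  exact and_congr_right fun _ => ⟨fun h a ha i => h i a ha, fun h i a ha => h a ha i⟩

theorem isSymmetric_homogeneousComponent {f : MvPolynomial (Fin k) R} (hf : f.IsSymmetric)
    (d : ℕ) : (homogeneousComponent d f).IsSymmetric := fun e => by
  rw [rename_homogeneousComponent, hf e]

theorem homogeneousComponent_mem_boundedSymm {m : ℕ} {f : MvPolynomial (Fin k) R}
    (hf : f ∈ boundedSymm R k m) (d : ℕ) : homogeneousComponent d f ∈ boundedSymm R k m := by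
  rw [mem_boundedSymm_iff_support] at hf ⊢
  refine ⟨isSymmetric_homogeneousComponent hf.1 d, fun a ha => hf.2 a ?_⟩
  rw [support_homogeneousComponent] at ha
  exact (Finset.mem_filter.mp ha).1

theorem homogeneousComponent_add_mul {f g : MvPolynomial (Fin k) R} {d : ℕ}
    (hg : g.IsHomogeneous d) (e : ℕ) :
    homogeneousComponent (d + e) (g * f) = g * homogeneousComponent e f := by
  conv_lhs => rw [← sum_homogeneousComponent f, Finset.mul_sum, map_sum]
  have h : ∀ i, homogeneousComponent (d + e) (g * homogeneousComponent i f) =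
      if e = i then g * homogeneousComponent i f else 0 := by
    intro i
    rw [homogeneousComponent_of_mem (hg.mul (homogeneousComponent_isHomogeneous i f))]
    simp
  simp only [h, Finset.sum_ite_eq, Finset.mem_range]
  split_ifs with he
  · rfl
  · rw [homogeneousComponent_eq_zero, mul_zero]
    omega

theorem homogeneousComponent_mul_eq_zero {f g : MvPolynomial (Fin k) R} {d e : ℕ}
    (hg : g.IsHomogeneous d) (he : e < d) : homogeneousComponent e (g * f) = 0 := by
  rw [← sum_homogeneousComponent f, Finset.mul_sum, map_sum]
  refine Finset.sum_eq_zero fun i _ => ?_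
  rw [homogeneousComponent_of_mem (hg.mul (homogeneousComponent_isHomogeneous i f)), if_neg]
  omega

/-- The combinations of `g (m + 1), …, g (m + k)` with symmetric coefficients. -/
def symmCombinations (g : ℕ → MvPolynomial (Fin k) R) (m : ℕ) :
    Submodule (symmetricSubalgebra (Fin k) R) (MvPolynomial (Fin k) R) :=
  Submodule.span _ (Set.range fun i : Fin k => g (m + 1 + (i : ℕ)))

theorem mul_mem_symmCombinations {g : ℕ → MvPolynomial (Fin k) R} {m : ℕ}
    {f c : MvPolynomial (Fin k) R} (hf : f ∈ symmCombinations g m) (hc : c.IsSymmetric) :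
    c * f ∈ symmCombinations g m :=
  Submodule.smul_mem _ (⟨c, hc⟩ : symmetricSubalgebra (Fin k) R) hf

theorem smul_mem_symmCombinations {g : ℕ → MvPolynomial (Fin k) R} {m : ℕ}
    {f : MvPolynomial (Fin k) R} (hf : f ∈ symmCombinations g m) (c : R) :
    c • f ∈ symmCombinations g m := by
  rw [smul_eq_C_mul]
  exact mul_mem_symmCombinations hf (IsSymmetric.C c)

theorem of_smul_mem_symmCombinations {g : ℕ → MvPolynomial (Fin k) R} {m : ℕ}
    {f : MvPolynomial (Fin k) R} {c : R} (hc : IsUnit c) (hf : c • f ∈ symmCombinations g m) :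
    f ∈ symmCombinations g m := by
  obtain ⟨c, rfl⟩ := hc
  have := smul_mem_symmCombinations hf (↑c⁻¹ : R)
  rwa [smul_smul, Units.inv_mul, one_smul] at this

theorem exists_eq_sum_of_mem_symmCombinations {g : ℕ → MvPolynomial (Fin k) R} {m : ℕ}
    {f : MvPolynomial (Fin k) R} (hf : f ∈ symmCombinations g m) :
    ∃ c : Fin k → MvPolynomial (Fin k) R, (∀ i, (c i).IsSymmetric) ∧
      f = ∑ i : Fin k, g (m + 1 + (i : ℕ)) * c i := by
  obtain ⟨c, rfl⟩ := (Submodule.mem_span_range_iff_exists_fun _).mp hf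
  refine ⟨fun i => c i, fun i => (c i).2, Finset.sum_congr rfl fun i _ => ?_⟩
  rw [Subalgebra.smul_def, smul_eq_mul, mul_comm]

/-- A graded version of Nakayama's lemma: if the symmetric polynomials of bounded degree span the
symmetric polynomials modulo the combinations of `g (m + 1), …, g (m + k)`, then they generate
them under multiplication by these elements. -/
theorem mem_of_forall_mem_sup {g : ℕ → MvPolynomial (Fin k) R} {m : ℕ}
    (hg : ∀ d, (g d).IsHomogeneous d) {W : Submodule R (MvPolynomial (Fin k) R)}
    (hW : ∀ i : Fin k, ∀ w ∈ W, g (m + 1 + (i : ℕ)) * w ∈ W) (hV : boundedSymm R k m ≤ W)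
    (hgen : ∀ f : MvPolynomial (Fin k) R, f.IsSymmetric →
      ∃ v ∈ boundedSymm R k m, f - v ∈ symmCombinations g m)
    {f : MvPolynomial (Fin k) R} (hf : f.IsSymmetric) : f ∈ W := by
  have key : ∀ d, ∀ f : MvPolynomial (Fin k) R, f.IsSymmetric → homogeneousComponent d f ∈ W := by
    intro d
    induction d using Nat.strong_induction_on with
    | _ d ih =>
      intro f hf
      obtain ⟨v, hv, hfv⟩ := hgen f hf
      obtain ⟨c, hc, hfc⟩ := exists_eq_sum_of_mem_symmCombinations hfv
      rw [sub_eq_iff_eq_add.mp hfc, map_add, map_sum]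
      refine Submodule.add_mem _ (Submodule.sum_mem _ fun i _ => ?_)
        (hV (homogeneousComponent_mem_boundedSymm hv d))
      -- Since `g (m + 1 + i)` has positive degree, only a component of `c i` of degree below `d`
      -- contributes, and the induction hypothesis applies to it.
      by_cases hi : m + 1 + (i : ℕ) ≤ d
      · obtain ⟨e, rfl⟩ := Nat.exists_eq_add_of_le hi
        rw [homogeneousComponent_add_mul (hg _)]
        exact hW i _ (ih e (by omega) _ (hc i))
      · rw [homogeneousComponent_mul_eq_zero (hg _) (not_le.mp hi)]
        exact W.zero_mem
  rw [← sum_homogeneousComponent f]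
  exact Submodule.sum_mem _ fun d _ => key d f hf

/-! ### Linear recurrences for power sums and complete homogeneous polynomials -/

/-- The series `∏ (1 - x_j t)`. -/
def vietaSeries (R : Type*) [CommRing R] (k : ℕ) : PowerSeries (MvPolynomial (Fin k) R) :=
  ∏ j : Fin k, (1 - PowerSeries.C (X j) * PowerSeries.X)

/-- The series `1 / (1 - x_l t)`. -/
def geomSeries (R : Type*) [CommRing R] {k : ℕ} (l : Fin k) :
    PowerSeries (MvPolynomial (Fin k) R) :=
  PowerSeries.mk fun a => X l ^ a

theorem geomSeries_mul (l : Fin k) :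
    geomSeries R l * (1 - PowerSeries.C (X l) * PowerSeries.X) = 1 := by
  ext1 d
  rw [mul_sub, mul_one, mul_left_comm, map_sub, PowerSeries.coeff_C_mul]
  cases d with
  | zero => simp [geomSeries]
  | succ d =>
    rw [PowerSeries.coeff_succ_mul_X, PowerSeries.coeff_one, if_neg (Nat.succ_ne_zero d)]
    simp [geomSeries, pow_succ']

theorem coeff_prod_one_sub_eq_zero {A ι : Type*} [CommRing A] (x : ι → A) (s : Finset ι) {d : ℕ}
    (hd : s.card < d) :
    PowerSeries.coeff d (∏ j ∈ s, (1 - PowerSeries.C (x j) * PowerSeries.X)) = 0 := by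
  classical
  induction s using Finset.induction_on generalizing d with
  | empty =>
    rw [Finset.prod_empty, PowerSeries.coeff_one, if_neg (by simp at hd; omega)]
  | insert a s ha ih =>
    rw [Finset.card_insert_of_notMem ha] at hd
    obtain ⟨d, rfl⟩ : ∃ e, d = e + 1 := ⟨d - 1, by omega⟩
    rw [Finset.prod_insert ha, sub_mul, one_mul, mul_assoc, map_sub, ih (by omega),
      PowerSeries.coeff_C_mul, mul_comm PowerSeries.X, PowerSeries.coeff_succ_mul_X,
      ih (by omega), mul_zero, sub_zero]

theorem vietaSeries_mul_geomSeries (l : Fin k) :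
    vietaSeries R k * geomSeries R l =
      ∏ j ∈ Finset.univ.erase l, (1 - PowerSeries.C (X j) * PowerSeries.X) := by
  rw [vietaSeries, ← Finset.mul_prod_erase _ _ (Finset.mem_univ l), mul_right_comm,
    mul_comm _ (geomSeries R l), geomSeries_mul, one_mul]

/-- One linear factor cancels, leaving a polynomial of degree at most `k - 1` in `t`. -/
theorem coeff_vietaSeries_mul_geomSeries {l : Fin k} {d : ℕ} (hd : k ≤ d) :
    PowerSeries.coeff d (vietaSeries R k * geomSeries R l) = 0 := by
  rw [vietaSeries_mul_geomSeries]
  refine coeff_prod_one_sub_eq_zero _ _ ?_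
  rw [Finset.card_erase_of_mem (Finset.mem_univ l), Finset.card_fin]
  have := l.2
  omega

theorem coeff_vietaSeries_eq_zero {d : ℕ} (hd : k < d) :
    PowerSeries.coeff d (vietaSeries R k) = 0 :=
  coeff_prod_one_sub_eq_zero _ _ (by simpa using hd)

theorem coeff_zero_vietaSeries : PowerSeries.coeff 0 (vietaSeries R k) = 1 := by
  rw [vietaSeries, PowerSeries.coeff_zero_eq_constantCoeff_apply, map_prod]
  simp

theorem isSymmetric_coeff_vietaSeries (d : ℕ) :
    (PowerSeries.coeff d (vietaSeries R k)).IsSymmetric := by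
  intro e
  have h : PowerSeries.map (rename e : MvPolynomial (Fin k) R →ₐ[R] _).toRingHom
      (vietaSeries R k) = vietaSeries R k := by
    rw [vietaSeries, map_prod]
    refine Fintype.prod_equiv e _ _ fun j => ?_
    simp
  conv_rhs => rw [← h]
  rw [PowerSeries.coeff_map]
  rfl

/-- A sequence satisfying the recurrence with characteristic polynomial `∏ (t - x_j)` lies
eventually in the span of `k` consecutive terms. -/
theorem mem_symmCombinations_of_recurrence {g : ℕ → MvPolynomial (Fin k) R} {m : ℕ}
    (hg : ∀ d, m + k < d → PowerSeries.coeff d (vietaSeries R k * PowerSeries.mk g) = 0)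
    {d : ℕ} (hd : m + 1 ≤ d) : g d ∈ symmCombinations g m := by
  induction d using Nat.strong_induction_on with
  | _ d ih =>
    by_cases h : d ≤ m + k
    · refine Submodule.subset_span ⟨⟨d - (m + 1), by omega⟩, ?_⟩
      dsimp only
      congr 1
      omega
    · have h0 := hg d (by omega)
      rw [PowerSeries.coeff_mul, Finset.Nat.sum_antidiagonal_eq_sum_range_succ_mk,
        Finset.sum_range_succ'] at h0
      simp only [coeff_zero_vietaSeries, one_mul, PowerSeries.coeff_mk, Nat.sub_zero] at h0
      -- The Vieta series has constant term `1`, so the vanishing coefficient can be solved for `g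
      -- d`. Its coefficients beyond `k` vanish, so only `g (d - 1), …, g (d - k)` remain, with
      -- indices at least `m + 1` because `d > m + k`.
      rw [← neg_eq_iff_add_eq_zero.mpr h0]
      refine Submodule.neg_mem _ (Submodule.sum_mem _ fun j hj => ?_)
      rw [Finset.mem_range] at hj
      by_cases hjk : k < j + 1
      · rw [coeff_vietaSeries_eq_zero hjk, zero_mul]
        exact Submodule.zero_mem _
      · exact mul_mem_symmCombinations (ih _ (by omega) (by omega))
          (isSymmetric_coeff_vietaSeries _)

theorem mk_psum : PowerSeries.mk (psum (Fin k) R) = ∑ l, geomSeries R l := by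
  ext1 d
  rw [map_sum]
  simp [psum, geomSeries]

/-- A coefficient of the product of geometric series is a sum over exponent vectors of fixed total
degree, and these correspond to the multisets indexing `hsymm`. -/
theorem mk_hsymm : PowerSeries.mk (hsymm (Fin k) R) = ∏ l, geomSeries R l := by
  ext1 d
  rw [PowerSeries.coeff_prod, PowerSeries.coeff_mk, hsymm]
  refine Finset.sum_bij (fun s _ => Multiset.toFinsupp s.1) (fun s _ => ?_) (fun s _ t _ h => ?_)
    (fun l hl => ?_) (fun s _ => ?_)
  · rw [Finset.mem_finsuppAntidiag]
    refine ⟨?_, Finset.subset_univ _⟩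
    rw [← Finset.sum_subset (Finset.subset_univ s.1.toFinset)]
    · simp
    · intro x _ hx
      simpa using hx
  · exact Subtype.ext (Multiset.toFinsupp.injective h)
  · rw [Finset.mem_finsuppAntidiag] at hl
    refine ⟨⟨Finsupp.toMultiset l, ?_⟩, Finset.mem_univ _, by simp⟩
    rw [Finsupp.card_toMultiset, Finsupp.sum_fintype _ _ (fun _ => rfl)]
    exact hl.1
  · rw [Finset.prod_multiset_map_count]
    simp only [geomSeries, PowerSeries.coeff_mk, Multiset.toFinsupp_apply]
    refine Finset.prod_subset (Finset.subset_univ _) fun x _ hx => ?_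
    rw [Multiset.count_eq_zero_of_notMem (by simpa using hx), pow_zero]

theorem vietaSeries_mul_mk_hsymm : vietaSeries R k * PowerSeries.mk (hsymm (Fin k) R) = 1 := by
  rw [mk_hsymm, vietaSeries, ← Finset.prod_mul_distrib]
  exact Finset.prod_eq_one fun l _ => by rw [mul_comm, geomSeries_mul]

theorem hsymm_mem_symmCombinations {m d : ℕ} (hd : m + 1 ≤ d) :
    hsymm (Fin k) R d ∈ symmCombinations (hsymm (Fin k) R) m := by
  refine mem_symmCombinations_of_recurrence (fun e he => ?_) hd
  rw [vietaSeries_mul_mk_hsymm, PowerSeries.coeff_one, if_neg (by omega)]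

theorem psum_mem_symmCombinations {m d : ℕ} (hd : m + 1 ≤ d) :
    psum (Fin k) R d ∈ symmCombinations (psum (Fin k) R) m := by
  refine mem_symmCombinations_of_recurrence (fun e he => ?_) hd
  rw [mk_psum, Finset.mul_sum, map_sum]
  exact Finset.sum_eq_zero fun l _ => coeff_vietaSeries_mul_geomSeries (by omega)

/-- The reduction of a high power of a variable: its coordinates with respect to low powers are
combinations of complete homogeneous symmetric polynomials. -/
theorem X_pow_eq_sum_hsymm_mul (l : Fin k) {a : ℕ} (ha : k ≤ a + 1) :
    (X l : MvPolynomial (Fin k) R) ^ a = ∑ j ∈ Finset.range k, hsymm (Fin k) R (a - j) *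
      ∑ x ∈ Finset.HasAntidiagonal.antidiagonal j,
        PowerSeries.coeff x.1 (vietaSeries R k) * X l ^ x.2 := by
  -- The factor `vietaSeries R k * geomSeries R l` is a polynomial of degree below `k`, so only `k`
  -- terms of the convolution survive. The hypothesis `ha` keeps `a - j` from being truncated.
  have h : geomSeries R l = vietaSeries R k * geomSeries R l *
      PowerSeries.mk (hsymm (Fin k) R) := by
    rw [mul_right_comm, vietaSeries_mul_mk_hsymm, one_mul]
  have h := congrArg (PowerSeries.coeff a) h
  rw [PowerSeries.coeff_mul, Finset.Nat.sum_antidiagonal_eq_sum_range_succ_mk] at h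
  have h1 : PowerSeries.coeff a (geomSeries R l) = X l ^ a := PowerSeries.coeff_mk _ _
  rw [← h1, h]
  refine (Finset.sum_subset (Finset.range_subset_range.mpr ha) fun j _ hj => ?_).symm.trans ?_
  · rw [coeff_vietaSeries_mul_geomSeries (by simpa using hj), zero_mul]
  · refine Finset.sum_congr rfl fun j _ => ?_
    rw [PowerSeries.coeff_mk, mul_comm, PowerSeries.coeff_mul]
    simp [geomSeries]

/-! ### Alternants and Schur polynomials -/

theorem monomial_equivFunOnFinite_symm (a : Fin k → ℕ) :
    monomial (Finsupp.equivFunOnFinite.symm a) (1 : R) = ∏ i, X i ^ a i := by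
  rw [monomial_eq, Finsupp.prod_fintype _ _ fun i => pow_zero _, C_1, one_mul]
  rfl

theorem rename_monomial_equivFunOnFinite_symm (a : Fin k → ℕ) (e : Equiv.Perm (Fin k)) :
    rename e (monomial (Finsupp.equivFunOnFinite.symm a) (1 : R)) =
      monomial (Finsupp.equivFunOnFinite.symm (a ∘ e.symm)) 1 := by
  rw [rename_monomial]
  congr 2
  ext i
  rw [Finsupp.mapDomain_equiv_apply]
  rfl

theorem alternant_eq_sum (a : Fin k → ℕ) :
    alternant R k a = ∑ e : Equiv.Perm (Fin k),
      Equiv.Perm.sign e • rename e (monomial (Finsupp.equivFunOnFinite.symm a) (1 : R)) := by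
  rw [alternant, ← Matrix.det_transpose, Matrix.det_apply]
  refine Finset.sum_congr rfl fun e _ => ?_
  rw [monomial_equivFunOnFinite_symm, map_prod]
  simp

theorem rename_alternant (a : Fin k → ℕ) (e : Equiv.Perm (Fin k)) :
    rename e (alternant R k a) = Equiv.Perm.sign e • alternant R k a := by
  have h : rename e (alternant R k a) =
      ((Matrix.of fun i j : Fin k => (X j : MvPolynomial (Fin k) R) ^ a i).submatrix id e).det := by
    rw [alternant, AlgHom.map_det]
    congr 1
    ext1 i j
    simp
  rw [h, Matrix.det_permute', alternant, Units.smul_def, zsmul_eq_mul]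

theorem alternant_comp (a : Fin k → ℕ) (e : Equiv.Perm (Fin k)) :
    alternant R k (a ∘ e) = Equiv.Perm.sign e • alternant R k a := by
  rw [Units.smul_def, zsmul_eq_mul, alternant, alternant, ← Matrix.det_permute]
  rfl

theorem alternant_eq_zero {a : Fin k → ℕ} (ha : ¬ Function.Injective a) :
    alternant R k a = 0 := by
  simp only [Function.Injective, not_forall] at ha
  obtain ⟨i, j, hij, hne⟩ := ha
  exact Matrix.det_zero_of_row_eq hne (by ext1 l; simp [hij])

theorem alternant_isHomogeneous (a : Fin k → ℕ) :
    (alternant R k a).IsHomogeneous (∑ i, a i) := by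
  rw [alternant_eq_sum]
  refine IsHomogeneous.sum _ _ _ fun e _ => ?_
  have h : (rename e (monomial (Finsupp.equivFunOnFinite.symm a) (1 : R))).IsHomogeneous
      (∑ i, a i) := by
    refine IsHomogeneous.rename_isHomogeneous (isHomogeneous_monomial _ ?_)
    rw [Finsupp.degree_eq_sum]
    rfl
  exact (homogeneousSubmodule (Fin k) R _).toAddSubgroup.zsmul_mem h _

theorem map_alternant {S : Type*} [CommRing S] (φ : R →+* S) (a : Fin k → ℕ) :
    map φ (alternant R k a) = alternant S k a := by
  rw [alternant, RingHom.map_det, alternant]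
  congr 1
  ext1 i j
  simp

/-- An alternant is an antisymmetrized monomial, and a symmetric factor can be moved inside the
antisymmetrization. -/
theorem mul_alternant {f : MvPolynomial (Fin k) R} (hf : f.IsSymmetric) (c : Fin k → ℕ) :
    f * alternant R k c = ∑ b ∈ f.support, f.coeff b • alternant R k fun i => b i + c i := by
  simp only [alternant_eq_sum, Finset.mul_sum, Finset.smul_sum]
  rw [Finset.sum_comm]
  refine Finset.sum_congr rfl fun e _ => ?_
  rw [mul_smul_comm]
  conv_lhs => rw [← hf e, ← map_mul, f.as_sum, Finset.sum_mul, map_sum, Finset.smul_sum]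
  refine Finset.sum_congr rfl fun b _ => ?_
  have h : monomial b (f.coeff b) * monomial (Finsupp.equivFunOnFinite.symm c) (1 : R) =
      f.coeff b • monomial (Finsupp.equivFunOnFinite.symm fun i => b i + c i) 1 := by
    rw [monomial_mul, smul_monomial, smul_eq_mul]
    congr 2
    ext i
    rfl
  rw [h, map_smul, smul_comm]

/-- The quotient `det (x_j ^ (a_i)) / det (x_j ^ (k - i))`. -/
def bialternant (R : Type*) [CommRing R] (k : ℕ) (a : Fin k → ℕ) : MvPolynomial (Fin k) R :=
  (existsUnique_mul_alternant R k a).choose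

theorem bialternant_mul (a : Fin k → ℕ) :
    bialternant R k a * alternant R k (staircase k) = alternant R k a :=
  (existsUnique_mul_alternant R k a).choose_spec.1

theorem eq_of_mul_alternant_eq {f g : MvPolynomial (Fin k) R}
    (h : f * alternant R k (staircase k) = g * alternant R k (staircase k)) : f = g :=
  (isRegular_alternant_staircase R k).right h

theorem isSymmetric_bialternant (a : Fin k → ℕ) : (bialternant R k a).IsSymmetric := by
  intro e
  have h := congrArg (rename e) (bialternant_mul (R := R) a)
  rw [map_mul, rename_alternant, rename_alternant, mul_smul_comm] at h
  exact eq_of_mul_alternant_eq ((smul_left_cancel _ h).trans (bialternant_mul a).symm)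

theorem map_bialternant {S : Type*} [CommRing S] (φ : R →+* S) (a : Fin k → ℕ) :
    map φ (bialternant R k a) = bialternant S k a := by
  have h := congrArg (map φ) (bialternant_mul (R := R) a)
  rw [map_mul, map_alternant, map_alternant] at h
  exact eq_of_mul_alternant_eq (h.trans (bialternant_mul a).symm)

/-- Numerator and denominator are homogeneous and the denominator is regular, so a component of the
quotient in any other degree must vanish. -/
theorem bialternant_isHomogeneous {a : Fin k → ℕ} {d : ℕ}
    (h : ∑ i, a i = d + ∑ i, staircase k i) : (bialternant R k a).IsHomogeneous d := by
  have hz : ∀ j, j ≠ d → homogeneousComponent j (bialternant R k a) = 0 := by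
    intro j hj
    refine eq_of_mul_alternant_eq ?_
    rw [zero_mul, mul_comm, ← homogeneousComponent_add_mul (alternant_isHomogeneous _), mul_comm,
      bialternant_mul, homogeneousComponent_of_mem (alternant_isHomogeneous a), if_neg]
    omega
  have hs : bialternant R k a = homogeneousComponent d (bialternant R k a) := by
    conv_lhs => rw [← sum_homogeneousComponent (bialternant R k a)]
    by_cases hd : d ∈ Finset.range ((bialternant R k a).totalDegree + 1)
    · exact Finset.sum_eq_single_of_mem d hd fun j _ hj => hz j hj
    · rw [homogeneousComponent_eq_zero d _ (by simpa [Nat.lt_succ_iff] using hd)]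
      exact Finset.sum_eq_zero fun j hj => hz j fun h => hd (h ▸ hj)
  rw [hs]
  exact homogeneousComponent_isHomogeneous d _

/-- The exponents `b` need not be decreasing here; `bialternant_mem_span_schur` straightens the
terms into Schur polynomials. -/
theorem eq_sum_bialternant {f : MvPolynomial (Fin k) R} (hf : f.IsSymmetric) :
    f = ∑ b ∈ f.support, f.coeff b • bialternant R k fun i => b i + staircase k i := by
  refine eq_of_mul_alternant_eq ?_
  rw [mul_alternant hf, Finset.sum_mul]
  exact Finset.sum_congr rfl fun b _ => by rw [smul_mul_assoc, bialternant_mul]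

theorem staircase_injective : Function.Injective (staircase k) := by
  intro i j h
  have := i.2
  have := j.2
  simp only [staircase] at h
  exact Fin.ext (by omega)

/-- The staircase has distinct entries, so its `k!` permuted monomials do not collide and every
coefficient is `±1`. -/
theorem coeff_alternant_staircase [Nontrivial R] (e : Equiv.Perm (Fin k)) :
    coeff (Finsupp.equivFunOnFinite.symm (staircase k ∘ e.symm))
      (alternant R k (staircase k)) ≠ 0 := by
  rw [alternant_eq_sum, coeff_sum, Finset.sum_eq_single e]
  · rw [rename_monomial_equivFunOnFinite_symm]
    rcases Int.units_eq_one_or (Equiv.Perm.sign e) with h | h <;> simp [h]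
  · intro e' _ hne
    have h0 : coeff (Finsupp.equivFunOnFinite.symm (staircase k ∘ e.symm))
        (rename e' (monomial (Finsupp.equivFunOnFinite.symm (staircase k)) (1 : R))) = 0 := by
      rw [rename_monomial_equivFunOnFinite_symm, coeff_monomial, if_neg]
      intro h
      have h := Finsupp.equivFunOnFinite.symm.injective h
      have h : e'.symm = e.symm := Equiv.ext fun i => staircase_injective (congrFun h i)
      exact hne (Equiv.symm_bijective.injective h)
    rcases Int.units_eq_one_or (Equiv.Perm.sign e') with h | h <;> simp [h, h0]
  · simp

theorem le_degreeOf_alternant_staircase [Nontrivial R] (i : Fin k) :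
    k - 1 ≤ (alternant R k (staircase k)).degreeOf i := by
  -- The transposition moves the largest exponent `k - 1`, at position `0`, to the variable `i`.
  have h := coeff_alternant_staircase (R := R) (Equiv.swap i ⟨0, i.pos⟩)
  have h := degreeOf_le_iff.mp (le_refl ((alternant R k (staircase k)).degreeOf i)) _
    (mem_support_iff.mpr h)
  simpa [staircase] using h

theorem degreeOf_alternant_le {a : Fin k → ℕ} {d : ℕ} (ha : ∀ i, a i ≤ d) (i : Fin k) :
    (alternant R k a).degreeOf i ≤ d := by
  rw [alternant_eq_sum]
  refine (degreeOf_sum_le _ _ _).trans (Finset.sup_le fun e _ => ?_)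
  rw [rename_monomial_equivFunOnFinite_symm]
  have h : (monomial (Finsupp.equivFunOnFinite.symm (a ∘ e.symm)) (1 : R)).degreeOf i ≤ d := by
    refine degreeOf_le_iff.mpr fun b hb => ?_
    rw [Finset.mem_singleton.mp (support_monomial_subset hb)]
    exact ha _
  rcases Int.units_eq_one_or (Equiv.Perm.sign e) with hs | hs
  · rwa [hs, one_smul]
  · rwa [hs, Units.neg_smul, one_smul, degreeOf_neg]

/-- The quotient of alternants has bounded degree in each variable. -/
theorem bialternant_mem_boundedSymm {a : Fin k → ℕ} {m : ℕ} (ha : ∀ i, a i < m + k) :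
    bialternant R k a ∈ boundedSymm R k m := by
  rw [mem_boundedSymm_iff_support]
  refine ⟨isSymmetric_bialternant a, fun b hb i => ?_⟩
  -- Over the domain `ℤ` degrees in a variable add: at most `m + k - 1` in the numerator and at
  -- least `k - 1` in the denominator leave at most `m`. Base change to `R` can only shrink the
  -- support.
  rw [← map_bialternant (Int.castRingHom R)] at hb
  have hb := support_map_subset _ _ hb
  have h0 : bialternant ℤ k a ≠ 0 := fun h => by simp [h] at hb
  have hk := i.pos
  have h1 := degreeOf_mul_eq (n := i) h0 (isRegular_alternant_staircase ℤ k).ne_zero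
  have h2 := le_degreeOf_alternant_staircase (R := ℤ) i
  have h3 := degreeOf_alternant_le (R := ℤ) (a := a) (d := m + k - 1)
    (fun j => by have := ha j; omega) i
  rw [bialternant_mul] at h1
  have h4 := degreeOf_le_iff.mp (le_refl ((bialternant ℤ k a).degreeOf i)) b hb
  omega

theorem schur_eq_bialternant (lam : YoungDiagram) (h : lam.rowLens.length ≤ k) :
    schur R k lam = bialternant R k fun i => lam.rowLen i + staircase k i := by
  refine eq_of_mul_alternant_eq ?_
  rw [schur_mul_alternant R k lam h, bialternant_mul]

theorem sum_rowLen_eq {lam : YoungDiagram} (h : lam.rowLens.length ≤ k) :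
    ∑ i : Fin k, lam.rowLen i = lam.rowLens.sum := by
  rw [YoungDiagram.length_rowLens] at h
  rw [YoungDiagram.rowLens, ← List.sum_toFinset _ List.nodup_range, List.toFinset_range,
    Fin.sum_univ_eq_sum_range (fun i => lam.rowLen i)]
  refine (Finset.sum_subset (Finset.range_subset_range.mpr h) fun i _ hi => ?_).symm
  by_contra h0
  have h1 : (i, 0) ∈ lam := YoungDiagram.mem_iff_lt_rowLen.mpr (Nat.pos_of_ne_zero h0)
  exact hi (Finset.mem_range.mpr (YoungDiagram.mem_iff_lt_colLen.mp h1))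

theorem schur_isHomogeneous {lam : YoungDiagram} (h : lam.rowLens.length ≤ k) :
    (schur R k lam).IsHomogeneous lam.rowLens.sum := by
  rw [schur_eq_bialternant lam h]
  refine bialternant_isHomogeneous ?_
  rw [Finset.sum_add_distrib, sum_rowLen_eq h]

theorem isSymmetric_schur {lam : YoungDiagram} (h : lam.rowLens.length ≤ k) :
    (schur R k lam).IsSymmetric := by
  rw [schur_eq_bialternant lam h]
  exact isSymmetric_bialternant _

theorem exists_boxPartition_rowLen_eq {m : ℕ} {L : Fin k → ℕ} (hL : Antitone L)
    (hm : ∀ i, L i ≤ m) : ∃ lam : BoxPartition k m, ∀ i : Fin k, lam.1.rowLen i = L i := by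
  let mu : YoungDiagram :=
    { cells := (Finset.range k ×ˢ Finset.range m).filter fun c =>
        ∃ h : c.1 < k, c.2 < L ⟨c.1, h⟩
      isLowerSet := by
        rintro ⟨i, j⟩ ⟨i', j'⟩ hle hc
        obtain ⟨hi, hj⟩ := Prod.mk_le_mk.mp hle
        simp only [Finset.coe_filter, Finset.mem_product, Finset.mem_range, Set.mem_ofPred_eq]
          at hc ⊢
        obtain ⟨⟨h1, h2⟩, h3, h4⟩ := hc
        have h5 : i' < k := by omega
        have h6 : L ⟨i, h3⟩ ≤ L ⟨i', h5⟩ := hL (Fin.mk_le_mk.mpr hi)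
        exact ⟨⟨h5, by omega⟩, h5, by omega⟩ }
  have hmem : ∀ i j, (i, j) ∈ mu ↔ ∃ h : i < k, j < L ⟨i, h⟩ := by
    intro i j
    rw [← YoungDiagram.mem_cells]
    simp only [mu, Finset.mem_filter, Finset.mem_product, Finset.mem_range]
    refine ⟨fun h => h.2, fun h => ⟨⟨h.1, ?_⟩, h⟩⟩
    obtain ⟨h1, h2⟩ := h
    have := hm ⟨i, h1⟩
    omega
  have hrow : ∀ i : Fin k, mu.rowLen i = L i := by
    intro i
    refine eq_of_forall_lt_iff fun j => ?_
    rw [← YoungDiagram.mem_iff_lt_rowLen, hmem]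
    exact ⟨fun h => h.2, fun h => ⟨i.2, h⟩⟩
  refine ⟨⟨mu, ?_, ?_⟩, hrow⟩
  · rw [YoungDiagram.length_rowLens]
    by_contra h
    rw [not_le, ← YoungDiagram.mem_iff_lt_colLen, hmem] at h
    exact absurd h.1 (lt_irrefl k)
  · rw [forall_mem_rowLens_le_iff]
    by_contra h
    rw [not_le, ← YoungDiagram.mem_iff_lt_rowLen, hmem] at h
    obtain ⟨h1, h2⟩ := h
    have := hm ⟨0, h1⟩
    omega

theorem add_le_of_strictAnti {f : Fin k → ℕ} (hf : StrictAnti f) (d : ℕ) {i j : Fin k}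
    (h : (j : ℕ) = i + d) : f j + d ≤ f i := by
  induction d generalizing j with
  | zero =>
    obtain rfl : j = i := Fin.ext h
    exact le_rfl
  | succ d ih =>
    have hj := j.2
    have h1 := ih (j := ⟨i + d, by omega⟩) rfl
    have h2 := hf (a := ⟨i + d, by omega⟩) (b := j) (Fin.lt_def.mpr (by simp only; omega))
    omega

/-- A repeated exponent gives `0`. Otherwise sorting costs a sign, and subtracting the staircase
from the decreasing exponents leaves a partition whose first part is at most `m + k - 1 - (k - 1) =
m`. -/
theorem bialternant_mem_span_schur {a : Fin k → ℕ} {m : ℕ} (ha : ∀ i, a i < m + k) :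
    bialternant R k a ∈
      Submodule.span R (Set.range fun lam : BoxPartition k m => schur R k lam.1) := by
  by_cases hinj : Function.Injective a
  · let e : Equiv.Perm (Fin k) := Fin.revPerm.trans (Tuple.sort a)
    have hanti : StrictAnti (a ∘ e) :=
      Antitone.strictAnti_of_injective
        (fun i j hij => Tuple.monotone_sort a (Fin.rev_le_rev.mpr hij)) (hinj.comp e.injective)
    have hle : ∀ i : Fin k, staircase k i ≤ (a ∘ e) i := by
      intro i
      have hi := i.2
      have := add_le_of_strictAnti hanti (k - 1 - i) (i := i) (j := ⟨k - 1, by omega⟩)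
        (by simp only; omega)
      simp only [staircase]
      omega
    obtain ⟨lam, hlam⟩ := exists_boxPartition_rowLen_eq (m := m)
      (L := fun i => (a ∘ e) i - staircase k i) (by
        intro i j hij
        have hj := j.2
        have hij := Fin.le_def.mp hij
        have := add_le_of_strictAnti hanti (j - i) (i := i) (j := j) (by omega)
        simp only [staircase]
        omega) (by
        intro i
        have hi := i.2
        have := add_le_of_strictAnti hanti i (i := ⟨0, i.pos⟩) (j := i) (by simp)
        have := ha (e ⟨0, i.pos⟩)
        simp only [staircase, Function.comp_apply] at *
        omega)
    have h : bialternant R k a = Equiv.Perm.sign e • schur R k lam.1 := by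
      refine eq_of_mul_alternant_eq ?_
      rw [bialternant_mul, smul_mul_assoc, schur_mul_alternant R k lam.1 lam.2.1]
      have : (fun i : Fin k => lam.1.rowLen i + staircase k i) = a ∘ e := by
        ext i
        rw [hlam, Nat.sub_add_cancel (hle i)]
      rw [this, alternant_comp, smul_smul, Int.units_mul_self, one_smul]
    rw [h]
    exact (Submodule.span R _).toAddSubgroup.zsmul_mem
      (Submodule.subset_span (Set.mem_range_self lam)) _
  · have h : bialternant R k a = 0 := eq_of_mul_alternant_eq (by
      rw [bialternant_mul, alternant_eq_zero hinj, zero_mul])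
    rw [h]
    exact Submodule.zero_mem _

theorem boundedSymm_le_span_schur (m : ℕ) : boundedSymm R k m ≤
    Submodule.span R (Set.range fun lam : BoxPartition k m => schur R k lam.1) := by
  intro f hf
  rw [mem_boundedSymm_iff_support] at hf
  rw [eq_sum_bialternant hf.1]
  refine Submodule.sum_mem _ fun b hb => Submodule.smul_mem _ _ (bialternant_mem_span_schur ?_)
  intro i
  have := hf.2 b hb i
  have := i.2
  simp only [staircase]
  omega

/-! ### Reduction modulo complete homogeneous polynomials -/

/-- In row `i` of the numerator, `X_pow_eq_sum_hsymm_mul` rewrites each high power with coefficients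
that do not depend on the column. They come out of the determinant by linearity in that row, and the
factors `h_{a i - j}`, `j < k`, all have index at least `m + 1`. -/
theorem bialternant_mem_symmCombinations {a : Fin k → ℕ} {m : ℕ} {i : Fin k}
    (ha : m + k ≤ a i) : bialternant R k a ∈ symmCombinations (hsymm (Fin k) R) m := by
  have h : bialternant R k a = ∑ j ∈ Finset.range k, hsymm (Fin k) R (a i - j) *
      ∑ x ∈ Finset.HasAntidiagonal.antidiagonal j,
        PowerSeries.coeff x.1 (vietaSeries R k) * bialternant R k (Function.update a i x.2) := by
    refine eq_of_mul_alternant_eq ?_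
    have hrow : ∀ b, alternant R k (Function.update a i b) =
        (Matrix.detRowAlternating.toMultilinearMap.toLinearMap
          (Matrix.of fun i j : Fin k => (X j : MvPolynomial (Fin k) R) ^ a i) i)
          (fun l => X l ^ b) := by
      intro b
      change _ = (Matrix.updateRow (Matrix.of fun i j : Fin k =>
        (X j : MvPolynomial (Fin k) R) ^ a i) i fun l => X l ^ b).det
      refine congrArg Matrix.det ?_
      ext1 r l
      rw [Matrix.of_apply, Matrix.updateRow_apply, Function.update_apply]
      split_ifs <;> rfl
    have hra := hrow (a i)
    rw [Function.update_eq_self] at hra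
    have hx : (fun l => (X l : MvPolynomial (Fin k) R) ^ a i) =
        ∑ j ∈ Finset.range k, hsymm (Fin k) R (a i - j) •
      ∑ x ∈ Finset.HasAntidiagonal.antidiagonal j,
        PowerSeries.coeff x.1 (vietaSeries R k) • fun l => X l ^ x.2 := by
      ext1 l
      rw [X_pow_eq_sum_hsymm_mul l (by omega)]
      simp [Finset.sum_apply]
    rw [bialternant_mul, hra, hx]
    simp only [map_sum, map_smul, ← hrow, smul_eq_mul, Finset.sum_mul, mul_assoc, bialternant_mul]
  rw [h]
  refine Submodule.sum_mem _ fun j hj => ?_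
  rw [mul_comm]
  rw [Finset.mem_range] at hj
  refine mul_mem_symmCombinations (hsymm_mem_symmCombinations (by omega)) ?_
  exact Subalgebra.sum_mem (symmetricSubalgebra (Fin k) R) fun x _ =>
    (isSymmetric_coeff_vietaSeries _).mul (isSymmetric_bialternant _)

/-- Modulo combinations of complete homogeneous symmetric polynomials, every symmetric polynomial
has bounded degree in each variable. -/
theorem exists_sub_mem_symmCombinations_hsymm (m : ℕ) {f : MvPolynomial (Fin k) R}
    (hf : f.IsSymmetric) :
    ∃ v ∈ boundedSymm R k m, f - v ∈ symmCombinations (hsymm (Fin k) R) m := by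
  classical
  -- The witness collects the bialternants with all exponents below `m + k`; every other term has a
  -- row that reduces.
  refine ⟨∑ b ∈ f.support with ∀ i, b i + staircase k i < m + k,
    f.coeff b • bialternant R k fun i => b i + staircase k i, ?_, ?_⟩
  · exact Submodule.sum_mem _ fun b hb => Submodule.smul_mem _ _
      (bialternant_mem_boundedSymm (Finset.mem_filter.mp hb).2)
  · have h := eq_sum_bialternant hf
    rw [← Finset.sum_filter_add_sum_filter_not f.support
      (fun b => ∀ i, b i + staircase k i < m + k)] at h
    rw [sub_eq_iff_eq_add'.mpr h]
    refine Submodule.sum_mem _ fun b hb => smul_mem_symmCombinations ?_ _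
    have hb := (Finset.mem_filter.mp hb).2
    push Not at hb
    obtain ⟨i, hi⟩ := hb
    exact bialternant_mem_symmCombinations hi

/-! ### Elementary products span the bounded symmetric polynomials -/

theorem degreeOf_esymm_le (d : ℕ) (i : Fin k) : (esymm (Fin k) R d).degreeOf i ≤ 1 := by
  rcases subsingleton_or_nontrivial R with hR | hR
  · rw [Subsingleton.elim (esymm (Fin k) R d) 0, degreeOf_zero]
    exact Nat.zero_le _
  refine (degreeOf_sum_le _ _ _).trans (Finset.sup_le fun s _ => ?_)
  refine (degreeOf_prod_le _ _ _).trans ?_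
  simp only [degreeOf_X]
  rw [Finset.sum_ite_eq]
  split_ifs <;> simp

theorem esymmMonomial_mem_boundedSymm {m : ℕ} {t : Fin k → ℕ} (ht : ∑ i, t i ≤ m) :
    esymmMonomial R k t ∈ boundedSymm R k m := by
  refine ⟨esymmMonomial_mem t, fun i => ((degreeOf_prod_le _ _ _).trans ?_).trans ht⟩
  refine Finset.sum_le_sum fun j _ => (degreeOf_pow_le _ _ _).trans ?_
  simpa using Nat.mul_le_mul_left (t j) (degreeOf_esymm_le (R := R) ((j : ℕ) + 1) i)

/-- This is the lexicographic leading-term algorithm for the fundamental theorem of symmetric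
polynomials. The point is that it stays within the bound: the subtracted monomial in the `e_i` has
total exponent at most `m`, and each `e_i` has degree at most one in each variable. -/
theorem boundedSymm_le_span_esymmMonomial (m : ℕ) : boundedSymm R k m ≤
    Submodule.span R (Set.range fun t : BoundedExponents k m => esymmMonomial R k t.1) := by
  intro p hp
  obtain rfl | h0 := eq_or_ne p 0
  · exact Submodule.zero_mem _
  induction he : p.supDegree toLex using WellFoundedLT.induction generalizing p with | _ t ih
  subst he
  let a := ofLex (p.supDegree toLex)
  let t := Finsupp.equivFunOnFinite.symm (Fin.invAccumulate k k a)
  have hacc : Fin.accumulate k k t = a :=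
    Fin.accumulate_invAccumulate le_rfl (IsSymmetric.antitone_supDegree hp.1)
  have hd : (esymmAlgHomMonomial (Fin k) t (p.leadingCoeff toLex)).supDegree toLex =
      p.supDegree toLex := by
    rw [← ofLex_inj, DFunLike.ext'_iff, supDegree_esymmAlgHomMonomial _ _ le_rfl]
    · exact hacc
    · rwa [Ne, AddMonoidAlgebra.leadingCoeff_eq_zero toLex.injective]
  have ha : a ∈ p.support := by
    rw [mem_support_iff]
    have := (AddMonoidAlgebra.leadingCoeff_eq_zero (p := p) toLex.injective).not.mpr h0
    rwa [leadingCoeff_toLex] at this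
  -- The exponents `t` are the successive differences of the leading exponent `a`, so their sum
  -- telescopes to the first entry of `a`, which is at most `m`.
  have ht : ∑ i, t i ≤ m := by
    rcases Nat.eq_zero_or_pos k with rfl | hk
    · simp
    · have h1 := (mem_boundedSymm_iff_support.mp hp).2 a ha ⟨0, hk⟩
      rw [← hacc, Fin.accumulate_apply] at h1
      simpa using h1
  have hmem : esymmAlgHomMonomial (Fin k) t (p.leadingCoeff toLex) ∈
      Submodule.span R (Set.range fun t : BoundedExponents k m => esymmMonomial R k t.1) := by
    rw [esymmAlgHomMonomial_eq]
    exact Submodule.smul_mem _ _ (Submodule.subset_span ⟨⟨t, ht⟩, rfl⟩)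
  have hbdd : esymmAlgHomMonomial (Fin k) t (p.leadingCoeff toLex) ∈ boundedSymm R k m := by
    rw [esymmAlgHomMonomial_eq]
    exact Submodule.smul_mem _ _ (esymmMonomial_mem_boundedSymm ht)
  obtain he | hne := eq_or_ne p (esymmAlgHomMonomial (Fin k) t (p.leadingCoeff toLex))
  · rw [he]
    exact hmem
  have := (AddMonoidAlgebra.supDegree_sub_lt_of_leadingCoeff_eq toLex.injective hd.symm
    (by rw [leadingCoeff_esymmAlgHomMonomial t le_rfl])).resolve_right hne
  have := ih _ this (Submodule.sub_mem _ hp hbdd) (sub_ne_zero.mpr hne) rfl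
  rw [← sub_add_cancel p (esymmAlgHomMonomial (Fin k) t (p.leadingCoeff toLex))]
  exact Submodule.add_mem _ this hmem

theorem esymmPart_transpose_eq {m : ℕ} (lam : BoxPartition k m) :
    esymmPart (Fin k) R (toPartition lam.1.transpose) =
      esymmMonomial R k (boxMultiplicities k m lam).1 := by
  rw [esymmPart, toPartition_parts]
  refine (prod_map_eq_prod_pow_count _ lam.conj.forall_mem).trans ?_
  refine Finset.prod_congr rfl fun i _ => ?_
  change esymm (Fin k) R (0 + 1 + (i : ℕ)) ^ multiplicities 0 k lam.conj i =
    esymm (Fin k) R _ ^ multiplicities 0 k lam.conj i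
  rw [zero_add, add_comm 1]

theorem boundedSymm_le_span_esymmPart (m : ℕ) : boundedSymm R k m ≤
    Submodule.span R (Set.range fun lam : BoxPartition k m =>
      esymmPart (Fin k) R (toPartition lam.1.transpose)) := by
  refine (boundedSymm_le_span_esymmMonomial m).trans (Submodule.span_mono ?_)
  rintro _ ⟨t, rfl⟩
  obtain ⟨lam, rfl⟩ := (boxMultiplicities_bijective k m).2 t
  exact ⟨lam, esymmPart_transpose_eq lam⟩

theorem esymmPart_transpose_isHomogeneous {m : ℕ} (lam : BoxPartition k m) :
    (esymmPart (Fin k) R (toPartition lam.1.transpose)).IsHomogeneous lam.1.rowLens.sum := by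
  rw [esymmPart_transpose_eq, ← weight_boxMultiplicities]
  exact esymmMonomial_isHomogeneous _

theorem isSymmetric_esymmPart_transpose {m : ℕ} (lam : BoxPartition k m) :
    (esymmPart (Fin k) R (toPartition lam.1.transpose)).IsSymmetric := by
  rw [esymmPart_transpose_eq]
  exact esymmMonomial_mem _

/-! ### Monomial symmetric polynomials span the bounded symmetric polynomials -/

/-- The nonzero exponents of a monomial. -/
def exponentParts (b : Fin k →₀ ℕ) : Multiset ℕ := b.support.val.map b

theorem exponentParts_eq_filter (b : Fin k →₀ ℕ) :
    exponentParts b = ((Finset.univ : Finset (Fin k)).val.map b).filter (· ≠ 0) := by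
  have h : b.support = Finset.univ.filter fun i => b i ≠ 0 := by
    ext i
    simp
  rw [exponentParts, h, Finset.filter_val, Multiset.filter_map]
  rfl

theorem eq_of_filter_ne_zero_eq {s t : Multiset ℕ} (hc : s.card = t.card)
    (h : s.filter (· ≠ 0) = t.filter (· ≠ 0)) : s = t := by
  have hs := Multiset.filter_add_not (· ≠ 0) s
  have ht := Multiset.filter_add_not (· ≠ 0) t
  have h0 : ∀ u : Multiset ℕ, u.filter (fun x => ¬ x ≠ 0) =
      Multiset.replicate (u.card - (u.filter (· ≠ 0)).card) 0 := by
    intro u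
    rw [Multiset.eq_replicate]
    refine ⟨?_, fun x hx => not_not.mp (Multiset.mem_filter.mp hx).2⟩
    have := congrArg Multiset.card (Multiset.filter_add_not (· ≠ 0) u)
    rw [Multiset.card_add] at this
    omega
  rw [← hs, ← ht, h0 s, h0 t, h, hc]

/-- Equal nonzero exponents force equally many zeros, since both vectors have length `k`. Bijections
between the fibres over each value then glue to a permutation. -/
theorem exists_perm_of_exponentParts_eq {a b : Fin k →₀ ℕ}
    (h : exponentParts a = exponentParts b) :
    ∃ e : Equiv.Perm (Fin k), ∀ i, b (e i) = a i := by
  rw [exponentParts_eq_filter, exponentParts_eq_filter] at h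
  have h := eq_of_filter_ne_zero_eq (by simp) h
  have hcard : ∀ c, Nonempty ({i // a i = c} ≃ {i // b i = c}) := by
    intro c
    have := congrArg (Multiset.count c) h
    rw [Multiset.count_map, Multiset.count_map] at this
    refine ⟨Fintype.equivOfCardEq ?_⟩
    rw [Fintype.card_subtype, Fintype.card_subtype]
    simp only [eq_comm (b := c)] at *
    exact this
  exact ⟨Equiv.ofFiberEquiv fun c => (hcard c).some, fun i =>
    Equiv.ofFiberEquiv_map _ i⟩

theorem sum_exponentParts (b : Fin k →₀ ℕ) : (exponentParts b).sum = (Finsupp.toMultiset b).card := by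
  rw [Finsupp.card_toMultiset]
  rfl

theorem coeff_msymm {n : ℕ} (mu : n.Partition) (b : Fin k →₀ ℕ) :
    coeff b (msymm (Fin k) R mu) = if exponentParts b = mu.parts then 1 else 0 := by
  have hmon : ∀ s : Multiset (Fin k),
      (s.map (X : Fin k → MvPolynomial (Fin k) R)).prod = monomial (Multiset.toFinsupp s) 1 := by
    intro s
    rw [monomial_eq, C_1, one_mul, Finset.prod_multiset_map_count]
    simp [Finsupp.prod]
  have hparts : ∀ s : Sym (Fin k) n,
      (Nat.Partition.ofSym s).parts = exponentParts (Multiset.toFinsupp s.1) := by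
    intro s
    rfl
  rw [msymm, coeff_sum]
  simp only [hmon, coeff_monomial]
  split_ifs with h
  · have hn : (Finsupp.toMultiset b).card = n := by
      rw [← sum_exponentParts, h, mu.parts_sum]
    rw [Finset.sum_eq_single ⟨⟨Finsupp.toMultiset b, hn⟩, Nat.Partition.ext ((hparts _).trans (by
        simpa using h))⟩]
    · simp
    · intro s _ hs
      rw [if_neg]
      rintro rfl
      exact hs (Subtype.ext (Subtype.ext (by simp)))
    · simp
  · refine Finset.sum_eq_zero fun s _ => if_neg ?_
    rintro rfl
    exact h ((hparts s.1).symm.trans (congrArg Nat.Partition.parts s.2))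

theorem msymm_isHomogeneous {n : ℕ} (mu : n.Partition) :
    (msymm (Fin k) R mu).IsHomogeneous n := by
  intro b hb
  rw [coeff_msymm] at hb
  have h : exponentParts b = mu.parts := by
    by_contra h
    exact hb (if_neg h)
  have hw : Finsupp.weight (1 : Fin k → ℕ) b = b.degree :=
    (DFunLike.congr_fun Finsupp.degree_eq_weight_one b).symm
  rw [← mu.parts_sum, ← h, hw, sum_exponentParts, Finsupp.card_toMultiset]
  rfl

theorem exists_boxPartition_exponentParts {m : ℕ} {b : Fin k →₀ ℕ} (hb : ∀ i, b i ≤ m) :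
    ∃ lam : BoxPartition k m, (lam.1.rowLens : Multiset ℕ) = exponentParts b := by
  have hpos : ∀ p ∈ exponentParts b, 0 < p := by
    intro p hp
    obtain ⟨i, hi, rfl⟩ := Multiset.mem_map.mp hp
    exact Nat.pos_of_ne_zero (Finsupp.mem_support_iff.mp hi)
  obtain ⟨mu, hmu⟩ := exists_rowLens_coe_eq _ hpos
  refine ⟨⟨mu, ?_, ?_⟩, hmu⟩
  · rw [← Multiset.coe_card, hmu, exponentParts, Multiset.card_map]
    exact (Finset.card_le_univ b.support).trans (Fintype.card_fin k).le
  · intro p hp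
    rw [← Multiset.mem_coe, hmu] at hp
    obtain ⟨i, -, rfl⟩ := Multiset.mem_map.mp hp
    exact hb i

theorem coeff_eq_of_exponentParts_eq {f : MvPolynomial (Fin k) R} (hf : f.IsSymmetric)
    {a b : Fin k →₀ ℕ} (h : exponentParts a = exponentParts b) : coeff a f = coeff b f := by
  obtain ⟨e, he⟩ := exists_perm_of_exponentParts_eq h
  have hm : Finsupp.mapDomain e a = b := by
    ext i
    rw [Finsupp.mapDomain_equiv_apply, ← he, Equiv.apply_symm_apply]
  rw [← hm]
  conv_rhs => rw [← hf e]
  rw [coeff_rename_mapDomain _ e.injective]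

/-- Coefficients of `f` are constant on permutation orbits of exponents, so subtracting `coeff a f •
m_λ` deletes the orbit of `a` and creates no new monomial. The support shrinks and the degree bound
persists. -/
theorem boundedSymm_le_span_msymm (m : ℕ) : boundedSymm R k m ≤
    Submodule.span R (Set.range fun lam : BoxPartition k m =>
      msymm (Fin k) R (toPartition lam.1)) := by
  intro f hf
  rw [mem_boundedSymm_iff_support] at hf
  induction hn : f.support.card using Nat.strong_induction_on generalizing f with
  | _ n ih =>
    by_cases h0 : f = 0
    · rw [h0]
      exact Submodule.zero_mem _
    obtain ⟨a, ha⟩ := support_nonempty.mpr h0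
    obtain ⟨lam, hlam⟩ := exists_boxPartition_exponentParts (hf.2 a ha)
    have hmem : coeff a f • msymm (Fin k) R (toPartition lam.1) ∈
        Submodule.span R (Set.range fun lam : BoxPartition k m =>
          msymm (Fin k) R (toPartition lam.1)) :=
      Submodule.smul_mem _ _ (Submodule.subset_span ⟨lam, rfl⟩)
    have hcoeff : ∀ b, coeff b (f - coeff a f • msymm (Fin k) R (toPartition lam.1)) =
        if exponentParts b = exponentParts a then 0 else coeff b f := by
      intro b
      rw [coeff_sub, coeff_smul, coeff_msymm, toPartition_parts, hlam]
      split_ifs with h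
      · rw [coeff_eq_of_exponentParts_eq hf.1 h]
        simp
      · simp
    have hsub : (f - coeff a f • msymm (Fin k) R (toPartition lam.1)).support ⊆
        f.support.erase a := by
      intro b hb
      rw [mem_support_iff, hcoeff] at hb
      split_ifs at hb with h
      · exact absurd rfl hb
      · exact Finset.mem_erase.mpr ⟨fun hba => h (by rw [hba]), mem_support_iff.mpr hb⟩
    have := ih _ (((Finset.card_le_card hsub).trans_lt (Finset.card_erase_lt_of_mem ha)).trans_eq hn)
      ⟨hf.1.sub ((msymm_isSymmetric _ _ _).smul _), fun b hb =>
        hf.2 b (Finset.mem_of_mem_erase (hsub hb))⟩ rfl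
    rw [← sub_add_cancel f (coeff a f • msymm (Fin k) R (toPartition lam.1))]
    exact Submodule.add_mem _ this hmem

/-! ### Reduction modulo power sums -/

/-- The sum of all permutations of a polynomial. -/
def symmetrization (R : Type*) [CommRing R] (k : ℕ) :
    MvPolynomial (Fin k) R →ₗ[R] MvPolynomial (Fin k) R :=
  ∑ e : Equiv.Perm (Fin k), (rename e : _ →ₐ[R] MvPolynomial (Fin k) R).toLinearMap

theorem symmetrization_apply (f : MvPolynomial (Fin k) R) :
    symmetrization R k f = ∑ e : Equiv.Perm (Fin k), rename e f := by
  simp [symmetrization, LinearMap.sum_apply]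

theorem isSymmetric_symmetrization (f : MvPolynomial (Fin k) R) :
    (symmetrization R k f).IsSymmetric := by
  intro e
  rw [symmetrization_apply, map_sum]
  refine Fintype.sum_equiv (Equiv.mulLeft e) _ _ fun e' => ?_
  rw [rename_rename]
  rfl

theorem symmetrization_rename (f : MvPolynomial (Fin k) R) (e : Equiv.Perm (Fin k)) :
    symmetrization R k (rename e f) = symmetrization R k f := by
  rw [symmetrization_apply, symmetrization_apply]
  refine Fintype.sum_equiv (Equiv.mulRight e) _ _ fun e' => ?_
  rw [rename_rename]
  rfl

theorem symmetrization_of_isSymmetric {f : MvPolynomial (Fin k) R} (hf : f.IsSymmetric) :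
    symmetrization R k f = ((k.factorial : ℕ) : R) • f := by
  rw [symmetrization_apply, Finset.sum_congr rfl fun e _ => hf e, Finset.sum_const,
    Finset.card_univ, Fintype.card_perm, Fintype.card_fin, Nat.cast_smul_eq_nsmul]

theorem mul_symmetrization {f : MvPolynomial (Fin k) R} (hf : f.IsSymmetric)
    (g : MvPolynomial (Fin k) R) : f * symmetrization R k g = symmetrization R k (f * g) := by
  simp only [symmetrization_apply, Finset.mul_sum, map_mul, hf _]

theorem symmetrization_mem_boundedSymm {m : ℕ} {a : Fin k →₀ ℕ} (ha : ∀ i, a i ≤ m) :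
    symmetrization R k (monomial a 1) ∈ boundedSymm R k m := by
  refine ⟨isSymmetric_symmetrization _, fun i => ?_⟩
  rw [symmetrization_apply]
  refine (degreeOf_sum_le _ _ _).trans (Finset.sup_le fun e _ => ?_)
  rw [rename_monomial]
  refine degreeOf_le_iff.mpr fun b hb => ?_
  rw [Finset.mem_singleton.mp (support_monomial_subset hb), Finsupp.mapDomain_equiv_apply]
  exact ha _

theorem psum_mul_symmetrization (q : ℕ) (b : Fin k →₀ ℕ) :
    psum (Fin k) R q * symmetrization R k (monomial b 1) =
      ∑ j, symmetrization R k (monomial (b + Finsupp.single j q) 1) := by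
  rw [mul_symmetrization (psum_isSymmetric _ _ q), psum, Finset.sum_mul, map_sum]
  refine Finset.sum_congr rfl fun j _ => ?_
  rw [X_pow_eq_monomial, monomial_mul, one_mul, add_comm]

/-- Moving the exponent `a i` to a position left vacant by erasing it is a transposition, which the
symmetrization does not see. -/
theorem symmetrization_add_single {a : Fin k →₀ ℕ} {i j : Fin k} (hj : a.erase i j = 0) :
    symmetrization R k (monomial (a.erase i + Finsupp.single j (a i)) 1) =
      symmetrization R k (monomial a 1) := by
  rw [← symmetrization_rename (monomial a 1) (Equiv.swap i j), rename_monomial]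
  congr 3
  ext l
  rw [Finsupp.mapDomain_equiv_apply, Equiv.symm_swap, Finsupp.add_apply]
  by_cases hl : l = j
  · subst hl
    rw [hj, Finsupp.single_eq_same, Equiv.swap_apply_right, zero_add]
  · rw [Finsupp.single_eq_of_ne hl, add_zero]
    by_cases hli : l = i
    · subst hli
      rw [Finsupp.erase_same, Equiv.swap_apply_left, ← hj, Finsupp.erase_ne (Ne.symm hl)]
    · rw [Finsupp.erase_ne hli, Equiv.swap_apply_of_ne_of_ne hli hl]

theorem isUnit_natCast_of_algebra_rat (R : Type*) [CommRing R] [Algebra ℚ R] {n : ℕ}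
    (hn : n ≠ 0) : IsUnit (n : R) := by
  have h : IsUnit (n : ℚ) := IsUnit.mk0 _ (Nat.cast_ne_zero.mpr hn)
  simpa using h.map (algebraMap ℚ R)

/-- Multiplying the symmetrization of `x^a` without its `i`-th exponent by `p_{a i}` puts that
exponent back in every position. Vacant positions all reproduce the original symmetrization;
occupied ones merge two exponents, giving smaller support to induct on. -/
theorem symmetrization_mem_symmCombinations [Algebra ℚ R] {m : ℕ} {a : Fin k →₀ ℕ} {i : Fin k}
    (ha : m + 1 ≤ a i) :
    symmetrization R k (monomial a 1) ∈ symmCombinations (psum (Fin k) R) m := by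
  induction hn : a.support.card using Nat.strong_induction_on generalizing a i with
  | _ n ih =>
    have h := psum_mul_symmetrization (R := R) (a i) (a.erase i)
    rw [← Finset.sum_filter_add_sum_filter_not Finset.univ (fun j => a.erase i j = 0),
      Finset.sum_congr rfl fun j hj => symmetrization_add_single (Finset.mem_filter.mp hj).2,
      Finset.sum_const, ← Nat.cast_smul_eq_nsmul R] at h
    -- Position `i` itself is vacant, so the multiplicity is a positive integer, hence a unit.
    have hi : i ∈ Finset.univ.filter fun j => a.erase i j = 0 := by simp
    refine of_smul_mem_symmCombinations (isUnit_natCast_of_algebra_rat R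
      (Finset.card_pos.mpr ⟨i, hi⟩).ne') ?_
    rw [← sub_eq_iff_eq_add.mpr h]
    refine Submodule.sub_mem _ ?_ (Submodule.sum_mem _ fun j hj => ?_)
    · rw [mul_comm]
      exact mul_mem_symmCombinations (psum_mem_symmCombinations ha) (isSymmetric_symmetrization _)
    · have hj := (Finset.mem_filter.mp hj).2
      have hs : (a.erase i + Finsupp.single j (a i)).support ⊆ a.support.erase i := by
        intro l hl
        rw [← Finsupp.support_erase]
        by_contra h
        have h0 := Finsupp.notMem_support_iff.mp h
        have hlj : l ≠ j := by
          rintro rfl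
          exact hj h0
        rw [Finsupp.mem_support_iff, Finsupp.add_apply, h0, Finsupp.single_eq_of_ne hlj] at hl
        exact hl rfl
      have hia : i ∈ a.support := Finsupp.mem_support_iff.mpr (by omega)
      refine ih _ (((Finset.card_le_card hs).trans_lt
        (Finset.card_erase_lt_of_mem hia)).trans_eq hn) (i := j) ?_ rfl
      rw [Finsupp.add_apply, Finsupp.single_eq_same]
      omega

/-- Over the rationals, every symmetric polynomial has bounded degree in each variable modulo
combinations of power sums. -/
theorem exists_sub_mem_symmCombinations_psum [Algebra ℚ R] (m : ℕ) {f : MvPolynomial (Fin k) R}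
    (hf : f.IsSymmetric) :
    ∃ v ∈ boundedSymm R k m, f - v ∈ symmCombinations (psum (Fin k) R) m := by
  classical
  have hu := isUnit_natCast_of_algebra_rat R k.factorial_ne_zero
  have h : ((k.factorial : ℕ) : R) • f =
      ∑ b ∈ f.support, f.coeff b • symmetrization R k (monomial b 1) := by
    rw [← symmetrization_of_isSymmetric hf]
    conv_lhs => rw [f.as_sum, map_sum]
    refine Finset.sum_congr rfl fun b _ => ?_
    rw [← map_smul, smul_monomial, smul_eq_mul, mul_one]
  -- Symmetrizing `f` multiplies it by `k!`, so the part of its symmetrized expansion with exponents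
  -- at most `m` must be divided by `k!`.
  refine ⟨(↑hu.unit⁻¹ : R) • ∑ b ∈ f.support with ∀ i, b i ≤ m,
    f.coeff b • symmetrization R k (monomial b 1), ?_, ?_⟩
  · exact Submodule.smul_mem _ _ (Submodule.sum_mem _ fun b hb => Submodule.smul_mem _ _
      (symmetrization_mem_boundedSymm (Finset.mem_filter.mp hb).2))
  · refine of_smul_mem_symmCombinations hu ?_
    rw [smul_sub, smul_smul, IsUnit.mul_val_inv, one_smul, h,
      ← Finset.sum_filter_add_sum_filter_not f.support (fun b => ∀ i, b i ≤ m),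
      add_sub_cancel_left]
    refine Submodule.sum_mem _ fun b hb => smul_mem_symmCombinations ?_ _
    have hb := (Finset.mem_filter.mp hb).2
    push Not at hb
    obtain ⟨i, hi⟩ := hb
    exact symmetrization_mem_symmCombinations hi

/-! ### Assembling the bases -/

theorem isHomogeneous_multiset_prod {g : ℕ → MvPolynomial (Fin k) R}
    (hg : ∀ d, (g d).IsHomogeneous d) (s : Multiset ℕ) :
    ((s.map g).prod).IsHomogeneous s.sum := by
  induction s using Multiset.induction_on with
  | empty => simpa using isHomogeneous_one (Fin k) R
  | cons a s ih =>
    rw [Multiset.map_cons, Multiset.prod_cons, Multiset.sum_cons]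
    exact (hg a).mul ih

theorem isSymmetric_multiset_prod {g : ℕ → MvPolynomial (Fin k) R}
    (hg : ∀ d, (g d).IsSymmetric) (s : Multiset ℕ) : ((s.map g).prod).IsSymmetric := by
  refine Subalgebra.multiset_prod_mem (symmetricSubalgebra (Fin k) R) fun x hx => ?_
  obtain ⟨d, -, rfl⟩ := Multiset.mem_map.mp hx
  exact hg d

/-- If the homogeneous symmetric polynomials `B lam` span the symmetric polynomials of bounded
degree, and these generate all symmetric polynomials modulo `g (m + 1), …, g (m + k)`, then the
products of the `B lam` with the monomials in `g (m + 1), …, g (m + k)` form a basis. -/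
theorem isSymmBasis_mul {m : ℕ} {B : BoxPartition k m → MvPolynomial (Fin k) R}
    {g : ℕ → MvPolynomial (Fin k) R} (hB : ∀ lam, (B lam).IsHomogeneous lam.1.rowLens.sum)
    (hBs : ∀ lam, (B lam).IsSymmetric)
    (hspan : boundedSymm R k m ≤ Submodule.span R (Set.range B))
    (hg : ∀ d, (g d).IsHomogeneous d) (hgs : ∀ d, (g d).IsSymmetric)
    (hgen : ∀ f : MvPolynomial (Fin k) R, f.IsSymmetric →
      ∃ v ∈ boundedSymm R k m, f - v ∈ symmCombinations g m) :
    IsSymmBasis fun x : BoxPartition k m × PartsBetween (m + 1) (m + k) =>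
      B x.1 * ((toPartition x.2.1).parts.map g).prod := by
  simp only [toPartition_parts]
  refine isSymmBasis_of_span (deg := pairDegree) (fun x => ?_)
    (fun x => (hBs x.1).mul (isSymmetric_multiset_prod hgs _)) (fun f hf => ?_)
    (finite_pairDegree_fiber k m) (card_pairDegree_fiber k m)
  · rw [pairDegree, ← Multiset.sum_coe x.2.1.rowLens]
    exact (hB x.1).mul (isHomogeneous_multiset_prod hg _)
  · refine mem_of_forall_mem_sup hg (fun i w hw => ?_) (hspan.trans ?_) hgen hf
    · induction hw using Submodule.span_induction with
      | mem w hw =>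
        obtain ⟨⟨lam, mu⟩, rfl⟩ := hw
        -- Multiplication by `g (m + 1 + i)` adds the part `m + 1 + i` to `mu`.
        obtain ⟨nu, hnu⟩ := PartsBetween.exists_eq (a := m) (b := m + k)
          (s := (m + 1 + (i : ℕ)) ::ₘ (mu.1.rowLens : Multiset ℕ)) (by
            intro p hp
            rcases Multiset.mem_cons.mp hp with rfl | hp
            · omega
            · exact mu.forall_mem p hp)
        refine Submodule.subset_span ⟨(lam, nu), ?_⟩
        dsimp only
        rw [hnu, Multiset.map_cons, Multiset.prod_cons, mul_left_comm]
      | zero => rw [mul_zero]; exact Submodule.zero_mem _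
      | add x y _ _ hx hy => rw [mul_add]; exact Submodule.add_mem _ hx hy
      | smul c x _ hx => rw [mul_smul_comm]; exact Submodule.smul_mem _ c hx
    · rw [Submodule.span_le]
      rintro _ ⟨lam, rfl⟩
      -- The empty partition gives the factor `1`, so the family contains every `B lam`.
      obtain ⟨nu, hnu⟩ := PartsBetween.exists_eq (a := m) (b := m + k) (s := 0) (by simp)
      refine Submodule.subset_span ⟨(lam, nu), ?_⟩
      dsimp only
      rw [hnu, Multiset.map_zero, Multiset.prod_zero, mul_one]

theorem psum_isHomogeneous (d : ℕ) : (psum (Fin k) R d).IsHomogeneous d :=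
  IsHomogeneous.sum _ _ _ fun i _ => isHomogeneous_X_pow i d

theorem hsymm_isHomogeneous (d : ℕ) : (hsymm (Fin k) R d).IsHomogeneous d := by
  refine IsHomogeneous.sum _ _ _ fun s _ => ?_
  have h : ∀ t : Multiset (Fin k),
      (t.map (X : Fin k → MvPolynomial (Fin k) R)).prod.IsHomogeneous t.card := by
    intro t
    induction t using Multiset.induction_on with
    | empty => simpa using isHomogeneous_one (Fin k) R
    | cons a t ih =>
      rw [Multiset.map_cons, Multiset.prod_cons, Multiset.card_cons, add_comm]
      exact (isHomogeneous_X R a).mul ih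
  have hs := h s.1
  rwa [s.2] at hs

theorem isSymmBasis_mul_parts {m : ℕ} {g : ℕ → MvPolynomial (Fin k) R}
    (hg : ∀ d, (g d).IsHomogeneous d) (hgs : ∀ d, (g d).IsSymmetric)
    (hgen : ∀ f : MvPolynomial (Fin k) R, f.IsSymmetric →
      ∃ v ∈ boundedSymm R k m, f - v ∈ symmCombinations g m) :
    (IsSymmBasis fun x : BoxPartition k m × PartsBetween (m + 1) (m + k) =>
      schur R k x.1.1 * ((toPartition x.2.1).parts.map g).prod) ∧
    (IsSymmBasis fun x : BoxPartition k m × PartsBetween (m + 1) (m + k) =>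
      msymm (Fin k) R (toPartition x.1.1) * ((toPartition x.2.1).parts.map g).prod) ∧
    (IsSymmBasis fun x : BoxPartition k m × PartsBetween (m + 1) (m + k) =>
      esymmPart (Fin k) R (toPartition x.1.1.transpose) *
        ((toPartition x.2.1).parts.map g).prod) :=
  ⟨isSymmBasis_mul (B := fun lam => schur R k lam.1) (fun lam => schur_isHomogeneous lam.2.1)
      (fun lam => isSymmetric_schur lam.2.1) (boundedSymm_le_span_schur m) hg hgs hgen,
    isSymmBasis_mul (B := fun lam => msymm (Fin k) R (toPartition lam.1))
      (fun lam => msymm_isHomogeneous (toPartition lam.1)) (fun _ => msymm_isSymmetric _ _ _)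
      (boundedSymm_le_span_msymm m) hg hgs hgen,
    isSymmBasis_mul (B := fun lam => esymmPart (Fin k) R (toPartition lam.1.transpose))
      esymmPart_transpose_isHomogeneous isSymmetric_esymmPart_transpose
      (boundedSymm_le_span_esymmPart m) hg hgs hgen⟩

end SymmBases

end

theorem theorem1p1 (k n : ℕ) (hkn : k ≤ n) :
    (∀ (R : Type*) [CommRing R] [Algebra ℚ R],
      SymmBases.IsSymmBasis (fun x : SymmBases.BoxPartition k (n - k) ×
          SymmBases.PartsBetween (n - k + 1) n =>
        SymmBases.schur R k x.1.1 *
          MvPolynomial.psumPart (Fin k) R (SymmBases.toPartition x.2.1)) ∧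
      SymmBases.IsSymmBasis (fun x : SymmBases.BoxPartition k (n - k) ×
          SymmBases.PartsBetween (n - k + 1) n =>
        MvPolynomial.msymm (Fin k) R (SymmBases.toPartition x.1.1) *
          MvPolynomial.psumPart (Fin k) R (SymmBases.toPartition x.2.1)) ∧
      SymmBases.IsSymmBasis (fun x : SymmBases.BoxPartition k (n - k) ×
          SymmBases.PartsBetween (n - k + 1) n =>
        MvPolynomial.esymmPart (Fin k) R (SymmBases.toPartition x.1.1.transpose) *
          MvPolynomial.psumPart (Fin k) R (SymmBases.toPartition x.2.1))) ∧
    (∀ (R : Type*) [CommRing R],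
      SymmBases.IsSymmBasis (fun x : SymmBases.BoxPartition k (n - k) ×
          SymmBases.PartsBetween (n - k + 1) n =>
        SymmBases.schur R k x.1.1 *
          MvPolynomial.hsymmPart (Fin k) R (SymmBases.toPartition x.2.1)) ∧
      SymmBases.IsSymmBasis (fun x : SymmBases.BoxPartition k (n - k) ×
          SymmBases.PartsBetween (n - k + 1) n =>
        MvPolynomial.msymm (Fin k) R (SymmBases.toPartition x.1.1) *
          MvPolynomial.hsymmPart (Fin k) R (SymmBases.toPartition x.2.1)) ∧
      SymmBases.IsSymmBasis (fun x : SymmBases.BoxPartition k (n - k) ×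
          SymmBases.PartsBetween (n - k + 1) n =>
        MvPolynomial.esymmPart (Fin k) R (SymmBases.toPartition x.1.1.transpose) *
          MvPolynomial.hsymmPart (Fin k) R (SymmBases.toPartition x.2.1))) := by
  -- Writing `n = m + k` removes the truncated subtraction.
  obtain ⟨m, rfl⟩ := Nat.exists_eq_add_of_le' hkn
  rw [Nat.add_sub_cancel]
  exact ⟨fun R _ _ => SymmBases.isSymmBasis_mul_parts SymmBases.psum_isHomogeneous
      (MvPolynomial.psum_isSymmetric _ _)
      fun _ hf => SymmBases.exists_sub_mem_symmCombinations_psum m hf,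
    fun R _ => SymmBases.isSymmBasis_mul_parts SymmBases.hsymm_isHomogeneous
      (MvPolynomial.hsymm_isSymmetric _ _)
      fun _ hf => SymmBases.exists_sub_mem_symmCombinations_hsymm m hf⟩
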